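/- **Setting.** Consider the lock-free sorted-list set of Herlihy and Shavit (Ch. 9.8). A *node* has an immutable key in $\mathbb Z\cup\{-\infty,+\infty\}$ and a field $next=(ref,mark)$ (a pointer and a Boolean), accessed atomically; a node is *marked* if its $mark$ is true. Initially there are only the sentinels $head$ (key $-\infty$, $next=(tail,false)$) and $tail$ (key $+\infty$, $next=(null,false)$). Nodes are never deallocated. $CAS(\&x.next,a,b)$ atomically sets $x.next$ to $b$ if its value is $a$, and fails otherwise. Any set of threads, each performing one operation after another with arbitrary integer arguments, executes the following code; the executions are the finite interleavings of their atomic steps (reading a field, a CAS, allocating a node), starting from the initial memory. * `find(k)`: start: $pred\leftarrow head$, $curr\leftarrow pred.next.ref$. Loop: $(succ,marked)\leftarrow curr.next$; while $marked$: execute $CAS(\&pred.next,(curr,false),(succ,false))$, restart `find` if it fails, otherwise $curr\leftarrow succ$, $(succ,marked)\leftarrow curr.next$; then if $curr.key<k$ set $pred\leftarrow curr$, $curr\leftarrow succ$ and repeat the loop, else return $(pred,curr)$. * `add(k)`: $(pred,succ)\leftarrow$ `find(k)`; if $succ.key=k$ return false; allocate a node $newNode$ with key $k$ and $next=(succ,false)$;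 execute $CAS(\&pred.next,(succ,false),(newNode,false))$; return true if it succeeds, otherwise restart. * `remove(k)`: $(pred,node)\leftarrow$ `find(k)`; if $node.key\ne k$ return false; $(succ,\_)\leftarrow node.next$; repeat: execute $CAS(\&node.next,(succ,false),(succ,true))$, then $(succ,marked)\leftarrow node.next$; if the CAS succeeded, call `find(k)` and return true; otherwise, if $marked$, return false. * `contains(k)` (no synchronization): $marked\leftarrow false$, $curr\leftarrow head$, $succ\leftarrow curr.next.ref$; while $curr.key<k$: $curr\leftarrow succ$, $(succ,marked)\leftarrow curr.next$; finally return $(curr.key=k\wedge\neg marked)$. A node is *reachable* if it can be reached from $head$ along $ref$ fields. Write $reach_k(x)$ if there are nodes $o_0=head,\dots,o_m=x$ $(m\ge 0)$ with $o_{i-1}.next.ref=o_i$ and $o_{i-1}.key<k$ for $1\le i\le m$. A node is *published* at a time if it is reachable then or was reachable earlier. The *abstract set* of a memory state is the set of integer keys of its reachable unmarked nodes. **Theorem.** Every execution has the following properties. 1. *Linearizability.* Its history of invocations and responses is linearizable with respect to the sequential set of integers, initially empty, in which `add(k)` inserts $k$ and returns whether $k$ was absent, `remove(k)` deletes $k$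 and returns whether $k$ was present, and `contains(k)` returns whether $k$ is present. 2. *State invariants.* At all times, $tail$ is reachable; every published unmarked node is reachable; and if $v$ is the $ref$-successor of a node $u$, then $u.key<v.key$. 3. *Transition invariants.* Keys are immutable; the $next$ field of a marked node is immutable; right after a node gets marked, it is reachable. 4. *Updates.* A successful CAS of `add(k)` changes the abstract set from some $S\not\ni k$ to $S\cup\{k\}$; a successful CAS of `remove(k)` (not in a call of `find`) changes it from some $S\ni k$ to $S\setminus\{k\}$; no other step, in particular no step of `find`, changes it. 5. *Find.* When `find(k)` returns $(pred,curr)$, then $pred.key<k\le curr.key$; at some time during this call, $pred$ was unmarked and its $ref$-successor was $curr$; and at some (perhaps different) time during this call, $curr$ was unmarked. 6. *Contains.* Whenever `contains(k)` is at the beginning of the body of its loop, $reach_k(curr)\wedge(curr.mark\Leftrightarrow marked)$ was true at some time between the invocation of this operation and now (for the present values of $curr$ and $marked$). When it has left the loop, then $k\le curr.key$, and at some time between the invocation and now, $reach_k(curr)$ was true and, unless $marked$ is true and $curr.key>k$, also $(curr.mark\Leftrightarrow marked)$ at that same time. -/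

import Mathlib

namespace LockFreeList

/-! ### Memory -/

/-- Keys stored in nodes: integers together with `-∞ = ⊥` and `+∞ = ⊤` for the sentinels. -/
abbrev Key := WithBot (WithTop ℤ)

/-- An integer regarded as a key of a node. -/
def toKey (k : ℤ) : Key := ((k : WithTop ℤ) : WithBot (WithTop ℤ))

/-- Addresses of nodes. -/
abbrev Loc := ℕ

/-- Pointers; `none` is `null`. -/
abbrev Ptr := Option Loc

/-- A node: its key, and the pair `next = (ref, mark)`, which is accessed atomically. -/
structure Node where
  key : Key
  next : Ptr × Bool

/-- The `ref` component of the field `next`. -/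
def Node.ref (n : Node) : Ptr := n.next.1

/-- The `mark` component of the field `next`. -/
def Node.mark (n : Node) : Bool := n.next.2

/-- A memory state; `h ℓ = none` means that no node is allocated at `ℓ`. -/
abbrev Heap := Loc → Option Node

/-- The address of the sentinel with key `-∞`. -/
def head : Loc := 0

/-- The address of the sentinel with key `+∞`. -/
def tail : Loc := 1

/-- The initial memory: `head` points to `tail`, `tail` points to `null`, nothing else exists. -/
def initHeap : Heap := fun ℓ =>
  if ℓ = head then some ⟨⊥, (some tail, false)⟩
  else if ℓ = tail then some ⟨⊤, (none, false)⟩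
  else none

/-- Overwrite (or create) the node at `ℓ`. -/
def Heap.write (h : Heap) (ℓ : Loc) (n : Node) : Heap := Function.update h ℓ (some n)

/-- `CasOk h ℓ old new h'`: the operation `CAS(&ℓ.next, old, new)` succeeds in `h`, giving `h'`. -/
def CasOk (h : Heap) (ℓ : Loc) (old new : Ptr × Bool) (h' : Heap) : Prop :=
  ∃ n, h ℓ = some n ∧ n.next = old ∧ h' = h.write ℓ { n with next := new }

/-- `CasFail h ℓ old`: the operation `CAS(&ℓ.next, old, _)` fails in `h`. -/
def CasFail (h : Heap) (ℓ : Loc) (old : Ptr × Bool) : Prop :=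
  ∃ n, h ℓ = some n ∧ n.next ≠ old

/-- `x` is reachable from `head` by following `ref` fields. -/
def Reachable (h : Heap) (x : Loc) : Prop :=
  Relation.ReflTransGen (fun a b => ∃ n, h a = some n ∧ n.ref = some b) head x

/-- There is a valid search path for `k` from `head` to `x`: a path of `ref` fields on which
every node, except possibly the last one, has a key smaller than `k`. -/
def SearchPath (h : Heap) (k : ℤ) (x : Loc) : Prop :=
  Relation.ReflTransGen
    (fun a b => ∃ n, h a = some n ∧ n.ref = some b ∧ n.key < toKey k) head x

/-- The abstract set represented by a memory state: the keys of the unmarked nodes of the list. -/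
def absSet (h : Heap) : Set ℤ :=
  {k | ∃ x n, Reachable h x ∧ h x = some n ∧ n.mark = false ∧ n.key = toKey k}

/-! ### The algorithm -/

/-- The operations of the set. Each of them returns a Boolean. -/
inductive Op where
  | add (k : ℤ)
  | remove (k : ℤ)
  | contains (k : ℤ)

/-- The externally visible actions of a thread: invoking an operation, and returning from it. -/
inductive Act where
  | call (op : Op)
  | ret (r : Bool)

/-- The place from which the internal procedure `find` is called: from `add`, from the beginning
of `remove`, or from `remove` after it has marked a node. -/
inductive Caller where
  | add
  | remove
  | cleanup

/-- Control states of a thread, with the values of the live local variables. -/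
inductive PC where
  /-- no operation is running -/
  | idle
  /-- the operation is about to return `r` -/
  | ret (r : Bool)
  /-- `find`: about to execute `pred ← head; curr ← pred.next.ref` -/
  | findStart (c : Caller) (k : ℤ)
  /-- `find`: about to execute `(succ, marked) ← curr.next` -/
  | findNext (c : Caller) (k : ℤ) (pred : Loc) (curr : Ptr)
  /-- `find`: about to test `marked` -/
  | findTest (c : Caller) (k : ℤ) (pred curr : Loc) (succ : Ptr) (marked : Bool)
  /-- `find` has just returned `(pred, curr)` to its caller -/
  | found (c : Caller) (k : ℤ) (pred curr : Loc)
  /-- `add`: about to execute `newNode ← new(k, (succ, false))` -/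
  | addNew (k : ℤ) (pred succ : Loc)
  /-- `add`: about to execute `CAS(&pred.next, (succ, false), (newNode, false))` -/
  | addCas (k : ℤ) (pred succ newNode : Loc)
  /-- `remove`: about to execute `(succ, _) ← nodeToRemove.next` before the loop -/
  | remRead (k : ℤ) (node : Loc)
  /-- `remove`: about to execute `CAS(&nodeToRemove.next, (succ, false), (succ, true))` -/
  | remCas (k : ℤ) (node : Loc) (succ : Ptr)
  /-- `remove`: about to execute `(succ, marked) ← nodeToRemove.next` after the `CAS` -/
  | remReread (k : ℤ) (node : Loc) (iMarkedIt : Bool)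
  /-- `contains`: about to execute `curr ← head; succ ← curr.next.ref`; here `marked = false` -/
  | conStart (k : ℤ)
  /-- `contains`: about to evaluate the loop condition `curr.key < k` -/
  | conTest (k : ℤ) (curr : Loc) (succ : Ptr) (marked : Bool)
  /-- `contains`: at the beginning of the loop body,
  about to execute `curr ← succ; (succ, marked) ← curr.next` -/
  | conBody (k : ℤ) (curr : Loc) (succ : Ptr) (marked : Bool)
  /-- `contains`: after the loop, about to execute `return (curr.key = k ∧ ¬ marked)` -/
  | conExit (k : ℤ) (curr : Loc) (marked : Bool)

/-- The control state in which an operation starts. -/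
def Op.start : Op → PC
  | .add k => .findStart .add k
  | .remove k => .findStart .remove k
  | .contains k => .conStart k

/-- The control states inside the procedure `find`. -/
def PC.InFind : PC → Prop
  | .findStart _ _ => True
  | .findNext _ _ _ _ => True
  | .findTest _ _ _ _ _ _ => True
  | _ => False

/-- The atomic steps of one thread. `LocalStep h p a h' p'` means that a thread in control state
`p` can, in one atomic action, change the memory from `h` to `h'` and its control state to `p'`;
`a` is the externally visible action performed, if any. Each step accesses shared memory at most
once, by reading a field `next` or `key`, by a `CAS`, or by allocating a new node. -/
inductive LocalStep : Heap → PC → Option Act → Heap → PC → Prop where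
  | call (h : Heap) (op : Op) :
      LocalStep h .idle (some (.call op)) h op.start
  | ret (h : Heap) (r : Bool) :
      LocalStep h (.ret r) (some (.ret r)) h .idle
  -- find
  | findStart (h : Heap) (c : Caller) (k : ℤ) (n : Node) (hn : h head = some n) :
      LocalStep h (.findStart c k) none h (.findNext c k head n.ref)
  | findNext (h : Heap) (c : Caller) (k : ℤ) (pred curr : Loc) (n : Node)
      (hn : h curr = some n) :
      LocalStep h (.findNext c k pred (some curr)) none h (.findTest c k pred curr n.ref n.mark)
  | findSnip (h h' : Heap) (c : Caller) (k : ℤ) (pred curr : Loc) (succ : Ptr)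
      (hc : CasOk h pred (some curr, false) (succ, false) h') :
      LocalStep h (.findTest c k pred curr succ true) none h' (.findNext c k pred succ)
  | findRestart (h : Heap) (c : Caller) (k : ℤ) (pred curr : Loc) (succ : Ptr)
      (hc : CasFail h pred (some curr, false)) :
      LocalStep h (.findTest c k pred curr succ true) none h (.findStart c k)
  | findAdvance (h : Heap) (c : Caller) (k : ℤ) (pred curr : Loc) (succ : Ptr) (n : Node)
      (hn : h curr = some n) (hk : n.key < toKey k) :
      LocalStep h (.findTest c k pred curr succ false) none h (.findNext c k curr succ)
  | findReturn (h : Heap) (c : Caller) (k : ℤ) (pred curr : Loc) (succ : Ptr) (n : Node)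
      (hn : h curr = some n) (hk : ¬ n.key < toKey k) :
      LocalStep h (.findTest c k pred curr succ false) none h (.found c k pred curr)
  -- add
  | addPresent (h : Heap) (k : ℤ) (pred succ : Loc) (n : Node)
      (hn : h succ = some n) (hk : n.key = toKey k) :
      LocalStep h (.found .add k pred succ) none h (.ret false)
  | addAbsent (h : Heap) (k : ℤ) (pred succ : Loc) (n : Node)
      (hn : h succ = some n) (hk : n.key ≠ toKey k) :
      LocalStep h (.found .add k pred succ) none h (.addNew k pred succ)
  | addNew (h : Heap) (k : ℤ) (pred succ newNode : Loc) (hfresh : h newNode = none) :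
      LocalStep h (.addNew k pred succ) none
        (h.write newNode ⟨toKey k, (some succ, false)⟩) (.addCas k pred succ newNode)
  | addOk (h h' : Heap) (k : ℤ) (pred succ newNode : Loc)
      (hc : CasOk h pred (some succ, false) (some newNode, false) h') :
      LocalStep h (.addCas k pred succ newNode) none h' (.ret true)
  | addRestart (h : Heap) (k : ℤ) (pred succ newNode : Loc)
      (hc : CasFail h pred (some succ, false)) :
      LocalStep h (.addCas k pred succ newNode) none h (.findStart .add k)
  -- remove
  | remAbsent (h : Heap) (k : ℤ) (pred succ : Loc) (n : Node)
      (hn : h succ = some n) (hk : n.key ≠ toKey k) :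
      LocalStep h (.found .remove k pred succ) none h (.ret false)
  | remPresent (h : Heap) (k : ℤ) (pred succ : Loc) (n : Node)
      (hn : h succ = some n) (hk : n.key = toKey k) :
      LocalStep h (.found .remove k pred succ) none h (.remRead k succ)
  | remRead (h : Heap) (k : ℤ) (node : Loc) (n : Node) (hn : h node = some n) :
      LocalStep h (.remRead k node) none h (.remCas k node n.ref)
  | remCasOk (h h' : Heap) (k : ℤ) (node : Loc) (succ : Ptr)
      (hc : CasOk h node (succ, false) (succ, true) h') :
      LocalStep h (.remCas k node succ) none h' (.remReread k node true)
  | remCasFail (h : Heap) (k : ℤ) (node : Loc) (succ : Ptr)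
      (hc : CasFail h node (succ, false)) :
      LocalStep h (.remCas k node succ) none h (.remReread k node false)
  | remMine (h : Heap) (k : ℤ) (node : Loc) (n : Node) (hn : h node = some n) :
      LocalStep h (.remReread k node true) none h (.findStart .cleanup k)
  | remLost (h : Heap) (k : ℤ) (node : Loc) (n : Node)
      (hn : h node = some n) (hm : n.mark = true) :
      LocalStep h (.remReread k node false) none h (.ret false)
  | remRetry (h : Heap) (k : ℤ) (node : Loc) (n : Node)
      (hn : h node = some n) (hm : n.mark = false) :
      LocalStep h (.remReread k node false) none h (.remCas k node n.ref)
  | remDone (h : Heap) (k : ℤ) (pred curr : Loc) :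
      LocalStep h (.found .cleanup k pred curr) none h (.ret true)
  -- contains
  | conStart (h : Heap) (k : ℤ) (n : Node) (hn : h head = some n) :
      LocalStep h (.conStart k) none h (.conTest k head n.ref false)
  | conEnter (h : Heap) (k : ℤ) (curr : Loc) (succ : Ptr) (marked : Bool) (n : Node)
      (hn : h curr = some n) (hk : n.key < toKey k) :
      LocalStep h (.conTest k curr succ marked) none h (.conBody k curr succ marked)
  | conLeave (h : Heap) (k : ℤ) (curr : Loc) (succ : Ptr) (marked : Bool) (n : Node)
      (hn : h curr = some n) (hk : ¬ n.key < toKey k) :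
      LocalStep h (.conTest k curr succ marked) none h (.conExit k curr marked)
  | conBody (h : Heap) (k : ℤ) (curr succ : Loc) (marked : Bool) (n : Node)
      (hn : h succ = some n) :
      LocalStep h (.conBody k curr (some succ) marked) none h (.conTest k succ n.ref n.mark)
  | conReturn (h : Heap) (k : ℤ) (curr : Loc) (marked : Bool) (n : Node)
      (hn : h curr = some n) :
      LocalStep h (.conExit k curr marked) none h (.ret (decide (n.key = toKey k) && !marked))

/-! ### Concurrent executions -/

/-- A global configuration: the shared memory and the control state of every thread. -/
structure Config (T : Type*) where
  heap : Heap
  pc : T → PC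

/-- One atomic step of some thread, the other threads keeping their control states. -/
def Step {T : Type*} [DecidableEq T] (C : Config T) (a : Option (T × Act)) (C' : Config T) : Prop :=
  ∃ (t : T) (b : Option Act) (p : PC), LocalStep C.heap (C.pc t) b C'.heap p ∧
    C'.pc = Function.update C.pc t p ∧ a = b.map (fun x => (t, x))

/-- A finite concurrent execution of `len` atomic steps, in which the threads in `T` invoke
arbitrary operations and interleave arbitrarily. Only the configurations at the times
`0, …, len` and the labels of the steps `0, …, len - 1` are meaningful. -/
structure Execution (T : Type*) [DecidableEq T] where
  len : ℕ
  cfg : ℕ → Config T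
  lab : ℕ → Option (T × Act)
  init : cfg 0 = ⟨initHeap, fun _ => .idle⟩
  step : ∀ i < len, Step (cfg i) (lab i) (cfg (i + 1))

namespace Execution

variable {T : Type*} [DecidableEq T] (e : Execution T)

/-- The memory at time `i`. -/
def heap (i : ℕ) : Heap := (e.cfg i).heap

/-- The control state of the thread `t` at time `i`. -/
def pc (i : ℕ) (t : T) : PC := (e.cfg i).pc t

/-- The history of the execution: its sequence of invocations and responses. -/
def history : List (T × Act) := (List.range e.len).filterMap e.lab

/-- At time `j`, the node at `x` is, or has earlier been, part of the list. -/
def Published (j : ℕ) (x : Loc) : Prop := ∃ i ≤ j, Reachable (e.heap i) x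

/-- `P` was true of the memory at some time between the invocation of the operation that the
thread `t` is executing at time `j`, and `j`. -/
def Past (t : T) (j : ℕ) (P : Heap → Prop) : Prop :=
  ∃ i ≤ j, P (e.heap i) ∧ ∀ m, i ≤ m → m ≤ j → e.pc m t ≠ .idle

/-- For a thread `t` to which `find` has returned and which has not moved since, up to time `j`:
`P` was true of the memory at some time during the traversal by that call of `find`. -/
def PastFind (t : T) (j : ℕ) (P : Heap → Prop) : Prop :=
  ∃ i ≤ j, P (e.heap i) ∧ (e.pc i t).InFind ∧
    ∀ m, i ≤ m → m ≤ j → (e.pc m t).InFind ∨ e.pc m t = e.pc j t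

end Execution

/-! ### Linearizability -/

/-- The set after a sequential execution of an operation on the set `S`. -/
def Op.next : Op → Set ℤ → Set ℤ
  | .add k, S => insert k S
  | .remove k, S => S \ {k}
  | .contains _, S => S

/-- The condition under which an operation, executed sequentially on `S`, returns `true`. -/
def Op.Succeeds : Op → Set ℤ → Prop
  | .add k, S => k ∉ S
  | .remove k, S => k ∈ S
  | .contains k, S => k ∈ S

/-- A sequence of operations with their results is a legal sequential run from the set `S`. -/
def Legal : Set ℤ → List (Op × Bool) → Prop
  | _, [] => True
  | S, (op, r) :: L => (r = true ↔ op.Succeeds S) ∧ Legal (op.next S) L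

/-- In the history `H`, the event at position `i` is an invocation of `op` by the thread `t`, and
the matching response is the event at position `j`, with result `r`. -/
def Completes {T : Type*} (H : List (T × Act)) (i j : ℕ) (t : T) (op : Op) (r : Bool) : Prop :=
  i < j ∧ H[i]? = some (t, .call op) ∧ H[j]? = some (t, .ret r) ∧
    ∀ m, i < m → m < j → ∀ r', H[m]? ≠ some (t, .ret r')

/-- Linearizability of a history `H` with respect to the sequential set, initially empty.
Operations are identified with the positions of their invocations in `H`. There is a sequence `L`
of operations of `H` with results, without repetition, which contains all completed operations with
the results they have in `H`, and possibly some pending operations, each completed by some result;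
`L` respects the real-time order of `H`, and is a legal sequential run. -/
def Linearizable {T : Type*} (H : List (T × Act)) : Prop :=
  ∃ L : List (ℕ × Op × Bool),
    (L.map Prod.fst).Nodup ∧
    (∀ x ∈ L, ∃ t, H[x.1]? = some (t, .call x.2.1)) ∧
    (∀ i j t op r, Completes H i j t op r → (i, op, r) ∈ L) ∧
    L.Pairwise (fun x y => ∀ j t op r, Completes H y.1 j t op r → ¬ j < x.1) ∧
    Legal ∅ (L.map Prod.snd)

end LockFreeList

namespace LockFreeList

/-! ### Paths in the heap -/

/-! The memory obeys one central invariant (`HeapInv`): keys increase strictly along `ref`, and a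
node that has ever been in the list and is still unmarked is still in it. Only four kinds of step
write: allocating a private node, linking it in, marking a node, unlinking a marked node. Each
preserves the invariant, keeps keys and leaves marked fields frozen (`HeapStep`). Sortedness makes
the keys of reachable nodes distinct, so linking in adds exactly one key, marking deletes exactly
one, and the other two writes change nothing. The successful CASes are therefore the linearization
points of the successful updates.

All other operations are linearized at a moment in the past. Whatever a thread has read is recorded
as a statement about an earlier moment of the same operation (`TimeInv`, proved in `timeInv`). For
`contains` the key lemma is `hindsight`. Let a node lie on a search path at time `i`, and let its
field be read at time `j`. If it is marked at `i`, its field is frozen and `i` serves. Otherwise, if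
its key is at most `k`, it is reachable at `j` when still unmarked, and right after its marking when
not; sortedness turns reachability into a search path. If its key exceeds `k`, time `i` serves
again: the marks can then disagree only if a mark was read, which is harmless because the answer is
false anyway.

Thus every operation that changes nothing has a `ReadPoint` between its invocation and its response;
a `remove` that loses the race for its node is placed just after the winner's marking. `Span.info`
carries these facts along the control states. In `exists_linearization` each time `i` receives a
block: the operations reading the memory at time `i`, then the update made by step `i`. The
concatenated blocks form a legal run, and they respect real time because each operation is placed
within its own interval. -/

/-- `b` is the `ref`-successor of `a`. -/
def Link (h : Heap) (a b : Loc) : Prop := ∃ n, h a = some n ∧ n.ref = some b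

theorem Link.unique {h : Heap} {a b c : Loc} (hb : Link h a b) (hc : Link h a c) : b = c := by
  obtain ⟨n, hn, hb⟩ := hb
  obtain ⟨m, hm, hc⟩ := hc
  rw [hn] at hm
  obtain rfl := Option.some.inj hm
  exact Option.some.inj (hb.symm.trans hc)

theorem Reachable.step {h : Heap} {x y : Loc} {n : Node} (hx : Reachable h x) (hn : h x = some n)
    (hy : n.ref = some y) : Reachable h y :=
  Relation.ReflTransGen.tail hx ⟨n, hn, hy⟩

theorem reachable_head (h : Heap) : Reachable h head := Relation.ReflTransGen.refl

theorem SearchPath.reachable {h : Heap} {k : ℤ} {x : Loc} (hx : SearchPath h k x) :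
    Reachable h x :=
  Relation.ReflTransGen.mono (fun _ _ ⟨n, hn, hr, _⟩ => ⟨n, hn, hr⟩) _ _ hx

theorem SearchPath.step {h : Heap} {k : ℤ} {x y : Loc} {n : Node} (hx : SearchPath h k x)
    (hn : h x = some n) (hy : n.ref = some y) (hk : n.key < toKey k) : SearchPath h k y :=
  Relation.ReflTransGen.tail hx ⟨n, hn, hy, hk⟩

/-- The invariant of the memory, where `P` is the set of all nodes published so far. -/
structure HeapInv (h : Heap) (P : Set Loc) : Prop where
  head : ∃ n, h head = some n ∧ n.key = ⊥ ∧ n.mark = false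
  tail : ∃ n, h tail = some n ∧ n.key = ⊤ ∧ n.mark = false
  sorted : ∀ x y n m, h x = some n → n.ref = some y → h y = some m → n.key < m.key
  closed : ∀ x y n, h x = some n → n.ref = some y → ∃ m, h y = some m
  alloc : ∀ x ∈ P, ∃ n, h x = some n
  reach : ∀ x, Reachable h x → x ∈ P
  unmarked : ∀ x ∈ P, ∀ n, h x = some n → n.mark = false → Reachable h x
  tail_mem : LockFreeList.tail ∈ P

namespace HeapInv

variable {h : Heap} {P : Set Loc}

/-- Each link raises the key strictly, so equality can occur only for the empty path. This is how
sortedness enters the statements about keys present or absent. -/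
theorem le_of_path (I : HeapInv h P) {a b : Loc} (hab : Relation.ReflTransGen (Link h) a b) :
    ∀ n m, h a = some n → h b = some m → n.key ≤ m.key ∧ (n.key = m.key → a = b) := by
  induction hab with
  | refl =>
    intro n m hn hm
    rw [hn] at hm
    obtain rfl := Option.some.inj hm
    simp
  | @tail b c hab hbc ih =>
    intro n m hn hm
    obtain ⟨o, ho, hr⟩ := hbc
    have h1 := (ih n o hn ho).1
    have h2 := I.sorted _ _ _ _ ho hr hm
    have h3 := lt_of_le_of_lt h1 h2
    exact ⟨h3.le, fun h => absurd h h3.ne⟩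

/-- In a sorted list, the path to a node with key at most `k` is a search path for `k`. -/
theorem searchPath (I : HeapInv h P) {k : ℤ} {x : Loc} (hx : Reachable h x) :
    ∀ n, h x = some n → n.key ≤ toKey k → SearchPath h k x := by
  induction hx with
  | refl => intros; exact Relation.ReflTransGen.refl
  | @tail b c hab hbc ih =>
    intro m hm hk
    obtain ⟨o, ho, hr⟩ := hbc
    have hlt := I.sorted _ _ _ _ ho hr hm
    exact (ih o ho (hlt.le.trans hk)).step ho hr (lt_of_lt_of_le hlt hk)

/-- Every reachable node either lies before the end of a given search path, or behind it. -/
theorem lt_or_path {k : ℤ} {x y : Loc} (hy : SearchPath h k y) (hx : Reachable h x) :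
    (∃ n, h x = some n ∧ n.key < toKey k) ∨ Relation.ReflTransGen (Link h) y x := by
  induction hy with
  | refl => exact Or.inr hx
  | @tail b c hab hbc ih =>
    obtain ⟨o, ho, hr, hk⟩ := hbc
    rcases ih with ih | ih
    · exact Or.inl ih
    · rcases Relation.ReflTransGen.cases_head ih with rfl | ⟨d, hd, hdx⟩
      · exact Or.inl ⟨o, ho, hk⟩
      · have : c = d := Link.unique ⟨o, ho, hr⟩ hd
        subst this
        exact Or.inr hdx

/-- A reachable node with key `k` cannot precede the end `y` of the search path, and behind `y` all
keys exceed that of `y`; so it would be `y` itself, which is marked in that case. All proofs of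
absence go through this lemma. -/
theorem notMem_absSet (I : HeapInv h P) {k : ℤ} {y : Loc} {m : Node} (hy : SearchPath h k y)
    (hm : h y = some m) (hk : toKey k ≤ m.key) (hmark : m.key = toKey k → m.mark = true) :
    k ∉ absSet h := by
  rintro ⟨x, n, hx, hn, hnm, hnk⟩
  rcases lt_or_path hy hx with ⟨n', hn', hlt⟩ | hp
  · rw [hn] at hn'
    obtain rfl := Option.some.inj hn'
    exact hlt.ne hnk
  · obtain ⟨hle, heq⟩ := I.le_of_path hp m n hm hn
    have hkk : m.key = n.key := le_antisymm hle (hnk.symm ▸ hk)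
    obtain rfl := heq hkk
    rw [hn] at hm
    obtain rfl := Option.some.inj hm
    rw [hmark hnk] at hnm
    exact absurd hnm (by simp)

/-- Distinct reachable nodes have distinct keys. -/
theorem eq_of_key_eq (I : HeapInv h P) {k : ℤ} {x y : Loc} {n m : Node} (hx : Reachable h x)
    (hy : Reachable h y) (hn : h x = some n) (hm : h y = some m) (hnk : n.key = toKey k)
    (hmk : m.key = toKey k) : x = y := by
  rcases lt_or_path (I.searchPath hy m hm hmk.le) hx with ⟨n', hn', hlt⟩ | hp
  · rw [hn] at hn'
    obtain rfl := Option.some.inj hn'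
    exact absurd hnk hlt.ne
  · exact ((I.le_of_path hp m n hm hn).2 (hmk.trans hnk.symm)).symm

end HeapInv

/-! ### Changes of the heap -/

/-- A change of the memory that respects the invariants, where `P` is the set of nodes published
before, and `X` holds of the nodes that become reachable. -/
structure HeapStep (P : Set Loc) (X : Loc → Prop) (h h' : Heap) : Prop where
  inv : HeapInv h' (P ∪ {x | Reachable h' x})
  next : ∀ x n, h x = some n → ∃ n', h' x = some n' ∧ n'.key = n.key ∧
    (n.mark = true → n'.next = n.next) ∧ (n.mark = false → n'.mark = true → Reachable h' x)
  fresh : ∀ x, Reachable h' x → Reachable h x ∨ X x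
  -- Keeps the private node of a thread between its allocation and its insertion intact while other
  -- threads move.
  frame : ∀ x n, x ∉ P → h x = some n → h' x = some n

theorem Heap.write_self (h : Heap) (a : Loc) (n : Node) : h.write a n a = some n := by
  simp [Heap.write]

theorem Heap.write_ne (h : Heap) {a x : Loc} (n : Node) (hx : x ≠ a) : h.write a n x = h x := by
  simp [Heap.write, hx]

theorem HeapStep.refl {h : Heap} {P : Set Loc} (I : HeapInv h P) :
    HeapStep P (fun _ => False) h h where
  inv := by
    have : P ∪ {x | Reachable h x} = P := Set.union_eq_left.2 I.reach
    rw [this]; exact I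
  next x n hn := ⟨n, hn, rfl, fun _ => rfl, fun h1 h2 => by rw [h1] at h2; simp at h2⟩
  fresh x hx := Or.inl hx
  frame _ _ _ h := h

/-! #### Allocation -/

theorem reachable_alloc {h : Heap} {P : Set Loc} (I : HeapInv h P) {a : Loc} {n : Node}
    (ha : h a = none) (x : Loc) : Reachable (h.write a n) x ↔ Reachable h x := by
  have hne : ∀ y, Reachable h y → y ≠ a := by
    rintro y hy rfl
    obtain ⟨m, hm⟩ := I.alloc _ (I.reach _ hy)
    rw [ha] at hm; cases hm
  constructor
  · intro hx
    induction hx with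
    | refl => exact reachable_head h
    | tail _ hbc ih =>
      obtain ⟨m, hm, hr⟩ := hbc
      rw [Heap.write_ne _ _ (hne _ ih)] at hm
      exact ih.step hm hr
  · intro hx
    induction hx with
    | refl => exact reachable_head _
    | tail hb hbc ih =>
      obtain ⟨m, hm, hr⟩ := hbc
      rw [← Heap.write_ne h n (hne _ hb)] at hm
      exact ih.step hm hr

/-- Sortedness is required of all allocated nodes, even private ones, hence the strict inequality
for the successor of the new node. Reachability is unaffected, since no reachable node points to a
free address. -/
theorem HeapStep.alloc {h : Heap} {P : Set Loc} (I : HeapInv h P) {a s : Loc} {q : Node} {k : ℤ}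
    (ha : h a = none) (hs : h s = some q) (hk : toKey k < q.key) :
    HeapStep P (fun _ => False) h (h.write a ⟨toKey k, (some s, false)⟩) := by
  have hR := reachable_alloc I (n := ⟨toKey k, (some s, false)⟩) ha
  have hold : ∀ {x n}, h x = some n → (h.write a ⟨toKey k, (some s, false)⟩) x = some n := by
    intro x n hn
    rw [Heap.write_ne _ _ (by rintro rfl; rw [ha] at hn; cases hn), hn]
  have hU : P ∪ {x | Reachable (h.write a ⟨toKey k, (some s, false)⟩) x} = P :=
    Set.union_eq_left.2 fun x hx => I.reach x ((hR x).1 hx)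
  refine ⟨?_, ?_, fun x hx => Or.inl ((hR x).1 hx), fun _ _ _ h => hold h⟩
  · rw [hU]
    constructor
    · obtain ⟨n, hn, h'⟩ := I.head; exact ⟨n, hold hn, h'⟩
    · obtain ⟨n, hn, h'⟩ := I.tail; exact ⟨n, hold hn, h'⟩
    · intro x y n m hn hr hm
      by_cases hx : x = a
      · subst hx
        rw [Heap.write_self] at hn
        obtain rfl := Option.some.inj hn
        obtain rfl : s = y := Option.some.inj hr
        rw [hold hs] at hm
        obtain rfl := Option.some.inj hm
        exact hk
      · rw [Heap.write_ne _ _ hx] at hn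
        obtain ⟨m', hm'⟩ := I.closed _ _ _ hn hr
        rw [hold hm'] at hm
        obtain rfl := Option.some.inj hm
        exact I.sorted _ _ _ _ hn hr hm'
    · intro x y n hn hr
      by_cases hx : x = a
      · subst hx
        rw [Heap.write_self] at hn
        obtain rfl := Option.some.inj hn
        obtain rfl : s = y := Option.some.inj hr
        exact ⟨q, hold hs⟩
      · rw [Heap.write_ne _ _ hx] at hn
        obtain ⟨m', hm'⟩ := I.closed _ _ _ hn hr
        exact ⟨m', hold hm'⟩
    · intro x hx
      obtain ⟨m, hm⟩ := I.alloc x hx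
      exact ⟨m, hold hm⟩
    · intro x hx
      exact I.reach x ((hR x).1 hx)
    · intro x hx n hn hm
      obtain ⟨m, hm'⟩ := I.alloc x hx
      rw [hold hm'] at hn
      obtain rfl := Option.some.inj hn
      exact (hR x).2 (I.unmarked x hx _ hm' hm)
    · exact I.tail_mem
  · intro x n hn
    exact ⟨n, hold hn, rfl, fun _ => rfl, fun h1 h2 => by rw [h1] at h2; simp at h2⟩

theorem absSet_alloc {h : Heap} {P : Set Loc} (I : HeapInv h P) {a : Loc} {n : Node}
    (ha : h a = none) : absSet (h.write a n) = absSet h := by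
  have hne : ∀ y, Reachable h y → y ≠ a := by
    rintro y hy rfl
    obtain ⟨m, hm⟩ := I.alloc _ (I.reach _ hy)
    rw [ha] at hm; cases hm
  ext k
  constructor
  · rintro ⟨x, m, hx, hm, h'⟩
    rw [reachable_alloc I ha] at hx
    rw [Heap.write_ne _ _ (hne x hx)] at hm
    exact ⟨x, m, hx, hm, h'⟩
  · rintro ⟨x, m, hx, hm, h'⟩
    exact ⟨x, m, (reachable_alloc I ha x).2 hx, (Heap.write_ne _ _ (hne x hx)).trans hm, h'⟩

/-! #### Changes of the field `next` of a published node -/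

/-- The parts of `HeapStep` that concern the effect of a `CAS` on an unmarked published node. -/
theorem HeapStep.of_cas {h : Heap} {P : Set Loc} {X : Loc → Prop} (I : HeapInv h P) {a : Loc}
    {n : Node} {r : Ptr} {b : Bool} (haP : a ∈ P) (hn : h a = some n) (hu : n.mark = false)
    (hb : b = true → n.key ≠ ⊥ ∧ n.key ≠ ⊤)
    (hr : ∀ y, r = some y → ∃ m, h y = some m ∧ n.key < m.key)
    (hX : ∀ x, X x → ∃ m, h x = some m)
    (hnew : ∀ x, Reachable (h.write a { n with next := (r, b) }) x → Reachable h x ∨ X x)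
    (hold : ∀ x m, Reachable h x → h x = some m → m.mark = false →
      Reachable (h.write a { n with next := (r, b) }) x) :
    HeapStep P X h (h.write a { n with next := (r, b) }) := by
  set h' := h.write a { n with next := (r, b) } with hh'
  have ha' : h' a = some { n with next := (r, b) } := Heap.write_self _ _ _
  have hne : ∀ {x}, x ≠ a → h' x = h x := fun hx => Heap.write_ne _ _ hx
  have hkey : ∀ {x m}, h x = some m → ∃ m', h' x = some m' ∧ m'.key = m.key := by
    intro x m hm
    by_cases hx : x = a
    · subst hx
      rw [hn] at hm
      obtain rfl := Option.some.inj hm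
      exact ⟨_, ha', rfl⟩
    · exact ⟨m, (hne hx).trans hm, rfl⟩
  have hkey' : ∀ {x m}, h' x = some m → ∃ m', h x = some m' ∧ m'.key = m.key := by
    intro x m hm
    by_cases hx : x = a
    · subst hx
      rw [ha'] at hm
      obtain rfl := Option.some.inj hm
      exact ⟨_, hn, rfl⟩
    · exact ⟨m, (hne hx).symm.trans hm, rfl⟩
  -- The modified node was itself unmarked and published, so `hold` applies to it. This also gives
  -- reachability right after marking.
  have hra : Reachable h' a := hold a n (I.unmarked a haP n hn hu) hn hu
  have hunm : ∀ {x m}, h x = some m → (m.key = ⊥ ∨ m.key = ⊤) → m.mark = false →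
      ∃ m', h' x = some m' ∧ m'.key = m.key ∧ m'.mark = false := by
    intro x m hm hk hmm
    by_cases hx : x = a
    · subst hx
      rw [hn] at hm
      obtain rfl := Option.some.inj hm
      refine ⟨_, ha', rfl, ?_⟩
      show b = false
      by_contra hb'
      obtain ⟨h1, h2⟩ := hb (by simpa using hb')
      exact hk.elim h1 h2
    · exact ⟨m, (hne hx).trans hm, rfl, hmm⟩
  refine ⟨⟨?_, ?_, ?_, ?_, ?_, ?_, ?_, ?_⟩, ?_, hnew, ?_⟩
  · obtain ⟨m, hm, hk, hmm⟩ := I.head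
    obtain ⟨m', h1, h2, h3⟩ := hunm hm (Or.inl hk) hmm
    exact ⟨m', h1, h2.trans hk, h3⟩
  · obtain ⟨m, hm, hk, hmm⟩ := I.tail
    obtain ⟨m', h1, h2, h3⟩ := hunm hm (Or.inr hk) hmm
    exact ⟨m', h1, h2.trans hk, h3⟩
  · intro x y p q hp hxy hq
    obtain ⟨q', hq', hkq⟩ := hkey' hq
    rw [← hkq]
    by_cases hx : x = a
    · subst hx
      rw [ha'] at hp
      obtain rfl := Option.some.inj hp
      obtain ⟨m, hm, hlt⟩ := hr y hxy
      rw [hq'] at hm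
      obtain rfl := Option.some.inj hm
      exact hlt
    · rw [hne hx] at hp
      exact I.sorted _ _ _ _ hp hxy hq'
  · intro x y p hp hxy
    have : ∃ m, h y = some m := by
      by_cases hx : x = a
      · subst hx
        rw [ha'] at hp
        obtain rfl := Option.some.inj hp
        obtain ⟨m, hm, -⟩ := hr y hxy
        exact ⟨m, hm⟩
      · rw [hne hx] at hp
        exact I.closed _ _ _ hp hxy
    obtain ⟨m, hm⟩ := this
    obtain ⟨m', hm', -⟩ := hkey hm
    exact ⟨m', hm'⟩
  · rintro x hx
    have : ∃ m, h x = some m := by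
      rcases hx with hx | hx
      · exact I.alloc x hx
      · rcases hnew x hx with hx | hx
        · exact I.alloc x (I.reach x hx)
        · exact hX x hx
    obtain ⟨m, hm⟩ := this
    obtain ⟨m', hm', -⟩ := hkey hm
    exact ⟨m', hm'⟩
  · intro x hx
    exact Or.inr hx
  · rintro x (hx | hx) m hm hmm
    · by_cases hxa : x = a
      · subst hxa; exact hra
      · rw [hne hxa] at hm
        exact hold x m (I.unmarked x hx m hm hmm) hm hmm
    · exact hx
  · exact Or.inl I.tail_mem
  · intro x m hm
    by_cases hx : x = a
    · subst hx
      rw [hn] at hm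
      obtain rfl := Option.some.inj hm
      exact ⟨_, ha', rfl, fun h => by rw [hu] at h; simp at h, fun _ _ => hra⟩
    · exact ⟨m, (hne hx).trans hm, rfl, fun _ => rfl,
        fun h1 h2 => by rw [h1] at h2; simp at h2⟩
  · intro x m hx hm
    rw [hne (by rintro rfl; exact hx haP), hm]

/-! #### Insertion -/

section Insert

variable {h : Heap} {P : Set Loc} {a s x : Loc} {n : Node} {k : ℤ}

theorem Node.ref_of_next {n : Node} {r : Ptr} {b : Bool} (h : n.next = (r, b)) : n.ref = r := by
  simp [Node.ref, h]

theorem Node.mark_of_next {n : Node} {r : Ptr} {b : Bool} (h : n.next = (r, b)) :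
    n.mark = b := by
  simp [Node.mark, h]

/-- The link from `a` to `s` is replaced by the detour through `x`. Conversely, the only link out of
`x` leads to `s`, which was already reachable through `a`. -/
theorem reachable_insert (I : HeapInv h P) (haP : a ∈ P) (hn : h a = some n)
    (hnext : n.next = (some s, false)) (hxP : x ∉ P)
    (hx : h x = some ⟨toKey k, (some s, false)⟩) (y : Loc) :
    Reachable (h.write a { n with next := (some x, false) }) y ↔ Reachable h y ∨ y = x := by
  have hxa : x ≠ a := by rintro rfl; exact hxP haP
  have ha' := Heap.write_self h a { n with next := (some x, false) }
  have hx' := (Heap.write_ne h { n with next := (some x, false) } hxa).trans hx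
  have hra : Reachable h a := I.unmarked a haP n hn (Node.mark_of_next hnext)
  have key : ∀ y, Reachable h y → Reachable (h.write a { n with next := (some x, false) }) y := by
    intro y hy
    induction hy with
    | refl => exact reachable_head _
    | @tail b c _ hbc ih =>
      obtain ⟨m, hm, hr⟩ := hbc
      by_cases hb : b = a
      · subst hb
        rw [hn] at hm
        obtain rfl := Option.some.inj hm
        rw [Node.ref_of_next hnext] at hr
        obtain rfl := Option.some.inj hr
        exact (ih.step ha' rfl).step hx' rfl
      · exact ih.step ((Heap.write_ne _ _ hb).trans hm) hr
  constructor
  · intro hy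
    induction hy with
    | refl => exact Or.inl (reachable_head h)
    | @tail b c _ hbc ih =>
      obtain ⟨m, hm, hr⟩ := hbc
      by_cases hb : b = a
      · subst hb
        rw [ha'] at hm
        obtain rfl := Option.some.inj hm
        exact Or.inr (Option.some.inj hr).symm
      · rw [Heap.write_ne _ _ hb] at hm
        rcases ih with ih | rfl
        · exact Or.inl (ih.step hm hr)
        · rw [hx] at hm
          obtain rfl := Option.some.inj hm
          obtain rfl := Option.some.inj hr
          exact Or.inl (hra.step hn (Node.ref_of_next hnext))
  · rintro (hy | rfl)
    · exact key y hy
    · exact (key a hra).step ha' rfl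

theorem HeapStep.insert (I : HeapInv h P) (haP : a ∈ P) (hn : h a = some n)
    (hnext : n.next = (some s, false)) (hk : n.key < toKey k) (hxP : x ∉ P)
    (hx : h x = some ⟨toKey k, (some s, false)⟩) :
    HeapStep P (fun y => y = x) h (h.write a { n with next := (some x, false) }) := by
  have hR := reachable_insert I haP hn hnext hxP hx
  refine HeapStep.of_cas I haP hn (Node.mark_of_next hnext) (by simp) ?_ ?_
    (fun y hy => (hR y).1 hy) (fun y m hy _ _ => (hR y).2 (Or.inl hy))
  · rintro y hy
    obtain rfl := Option.some.inj hy
    exact ⟨_, hx, hk⟩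
  · rintro y rfl
    exact ⟨_, hx⟩

/-- The search path to `a` extends by one link to `s`, whose key is beyond `k`. The lemma serves
both a successful `add` and a `remove` that does not find its key. -/
theorem notMem_absSet_of_gap (I : HeapInv h P) (haP : a ∈ P) (hn : h a = some n)
    (hnext : n.next = (some s, false)) (hk : n.key < toKey k) {q : Node} (hs : h s = some q)
    (hq : toKey k < q.key) : k ∉ absSet h := by
  have hra : Reachable h a := I.unmarked a haP n hn (Node.mark_of_next hnext)
  exact I.notMem_absSet ((I.searchPath hra n hn hk.le).step hn (Node.ref_of_next hnext) hk) hs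
    hq.le (fun h => absurd h hq.ne')

theorem toKey_injective {i j : ℤ} (h : toKey i = toKey j) : i = j := by
  have := WithBot.coe_injective h
  exact WithTop.coe_injective this

theorem absSet_insert (I : HeapInv h P) (haP : a ∈ P) (hn : h a = some n)
    (hnext : n.next = (some s, false)) (hxP : x ∉ P)
    (hx : h x = some ⟨toKey k, (some s, false)⟩) :
    absSet (h.write a { n with next := (some x, false) }) = insert k (absSet h) := by
  have hR := reachable_insert I haP hn hnext hxP hx
  have hxa : x ≠ a := by rintro rfl; exact hxP haP
  have ha' := Heap.write_self h a { n with next := (some x, false) }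
  have hx' := (Heap.write_ne h { n with next := (some x, false) } hxa).trans hx
  ext i
  constructor
  · rintro ⟨y, m, hy, hm, hmm, hmk⟩
    rcases (hR y).1 hy with hy' | rfl
    · right
      by_cases hya : y = a
      · subst hya
        rw [ha'] at hm
        obtain rfl := Option.some.inj hm
        exact ⟨y, n, hy', hn, Node.mark_of_next hnext, hmk⟩
      · rw [Heap.write_ne _ _ hya] at hm
        exact ⟨y, m, hy', hm, hmm, hmk⟩
    · rw [hx'] at hm
      obtain rfl := Option.some.inj hm
      exact Or.inl (toKey_injective hmk).symm
  · rintro (rfl | ⟨y, m, hy, hm, hmm, hmk⟩)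
    · exact ⟨x, _, (hR x).2 (Or.inr rfl), hx', rfl, rfl⟩
    · by_cases hya : y = a
      · subst hya
        rw [hn] at hm
        obtain rfl := Option.some.inj hm
        exact ⟨y, _, (hR y).2 (Or.inl hy), ha', rfl, hmk⟩
      · exact ⟨y, m, (hR y).2 (Or.inl hy), (Heap.write_ne _ _ hya).trans hm, hmm, hmk⟩

end Insert

/-! #### Unlinking a marked node -/

section Snip

variable {h : Heap} {P : Set Loc} {a c : Loc} {n q : Node} {r : Ptr}

/-- The new link out of `a` is a shortcut for the two old links through `c`. -/
theorem reachable_of_snip (I : HeapInv h P) (haP : a ∈ P) (hn : h a = some n)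
    (hnext : n.next = (some c, false)) (hc : h c = some q) (hq : q.next = (r, true)) {y : Loc}
    (hy : Reachable (h.write a { n with next := (r, false) }) y) : Reachable h y := by
  have hra : Reachable h a := I.unmarked a haP n hn (Node.mark_of_next hnext)
  induction hy with
  | refl => exact reachable_head h
  | @tail b d _ hbd ih =>
    obtain ⟨m, hm, hr⟩ := hbd
    by_cases hb : b = a
    · subst hb
      rw [Heap.write_self] at hm
      obtain rfl := Option.some.inj hm
      exact (hra.step hn (Node.ref_of_next hnext)).step hc ((Node.ref_of_next hq).trans hr)
    · rw [Heap.write_ne _ _ hb] at hm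
      exact ih.step hm hr

/-- Only `c` may get lost. Its alternative retains the reachability of `a`, so that an old path
through `c` can resume with the shortcut from `a`. -/
theorem reachable_snip (hn : h a = some n) (hnext : n.next = (some c, false))
    (hc : h c = some q) (hq : q.next = (r, true)) {y : Loc} (hy : Reachable h y) :
    Reachable (h.write a { n with next := (r, false) }) y ∨
      y = c ∧ Reachable (h.write a { n with next := (r, false) }) a := by
  have ha' := Heap.write_self h a { n with next := (r, false) }
  induction hy with
  | refl => exact Or.inl (reachable_head _)
  | @tail b d _ hbd ih =>
    obtain ⟨m, hm, hr⟩ := hbd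
    rcases ih with ih | ⟨rfl, ih⟩
    · by_cases hb : b = a
      · subst hb
        rw [hn] at hm
        obtain rfl := Option.some.inj hm
        rw [Node.ref_of_next hnext] at hr
        exact Or.inr ⟨(Option.some.inj hr).symm, ih⟩
      · exact Or.inl (ih.step ((Heap.write_ne _ _ hb).trans hm) hr)
    · rw [hc] at hm
      obtain rfl := Option.some.inj hm
      exact Or.inl (ih.step ha' ((Node.ref_of_next hq).symm.trans hr))

theorem reachable_snip_of_unmarked (hn : h a = some n) (hnext : n.next = (some c, false))
    (hc : h c = some q) (hq : q.next = (r, true)) {y : Loc} {m : Node} (hy : Reachable h y)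
    (hm : h y = some m) (hmm : m.mark = false) :
    Reachable (h.write a { n with next := (r, false) }) y := by
  rcases reachable_snip hn hnext hc hq hy with hy | ⟨rfl, -⟩
  · exact hy
  · rw [hc] at hm
    obtain rfl := Option.some.inj hm
    rw [Node.mark_of_next hq] at hmm
    cases hmm

theorem HeapStep.snip (I : HeapInv h P) (haP : a ∈ P) (hn : h a = some n)
    (hnext : n.next = (some c, false)) (hc : h c = some q) (hq : q.next = (r, true)) :
    HeapStep P (fun _ => False) h (h.write a { n with next := (r, false) }) := by
  refine HeapStep.of_cas I haP hn (Node.mark_of_next hnext) (by simp) ?_ (fun _ h => h.elim)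
    (fun y hy => Or.inl (reachable_of_snip I haP hn hnext hc hq hy))
    (fun y m hy hm hmm => reachable_snip_of_unmarked hn hnext hc hq hy hm hmm)
  intro y hy
  have hqr := (Node.ref_of_next hq).trans hy
  obtain ⟨m, hm⟩ := I.closed _ _ _ hc hqr
  exact ⟨m, hm, (I.sorted _ _ _ _ hn (Node.ref_of_next hnext) hc).trans
    (I.sorted _ _ _ _ hc hqr hm)⟩

theorem absSet_snip (I : HeapInv h P) (haP : a ∈ P) (hn : h a = some n)
    (hnext : n.next = (some c, false)) (hc : h c = some q) (hq : q.next = (r, true)) :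
    absSet (h.write a { n with next := (r, false) }) = absSet h := by
  have ha' := Heap.write_self h a { n with next := (r, false) }
  ext i
  constructor
  · rintro ⟨y, m, hy, hm, hmm, hmk⟩
    have hy' := reachable_of_snip I haP hn hnext hc hq hy
    by_cases hya : y = a
    · subst hya
      rw [ha'] at hm
      obtain rfl := Option.some.inj hm
      exact ⟨y, n, hy', hn, Node.mark_of_next hnext, hmk⟩
    · rw [Heap.write_ne _ _ hya] at hm
      exact ⟨y, m, hy', hm, hmm, hmk⟩
  · rintro ⟨y, m, hy, hm, hmm, hmk⟩
    have hy' := reachable_snip_of_unmarked hn hnext hc hq hy hm hmm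
    by_cases hya : y = a
    · subst hya
      rw [hn] at hm
      obtain rfl := Option.some.inj hm
      exact ⟨y, _, hy', ha', rfl, hmk⟩
    · exact ⟨y, m, hy', (Heap.write_ne _ _ hya).trans hm, hmm, hmk⟩

end Snip

/-! #### Marking -/

section Mark

variable {h : Heap} {P : Set Loc} {a : Loc} {n : Node} {r : Ptr} {k : ℤ}

theorem link_mark (hn : h a = some n) (hnext : n.next = (r, false)) :
    Link (h.write a { n with next := (r, true) }) = Link h := by
  funext b d
  by_cases hb : b = a
  · subst hb
    simp [Link, Heap.write_self, hn, Node.ref, hnext]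
  · simp [Link, Heap.write_ne _ _ hb]

theorem reachable_mark (hn : h a = some n) (hnext : n.next = (r, false)) (y : Loc) :
    Reachable (h.write a { n with next := (r, true) }) y ↔ Reachable h y := by
  change Relation.ReflTransGen (Link _) head y ↔ Relation.ReflTransGen (Link h) head y
  rw [link_mark hn hnext]

theorem toKey_ne_bot (k : ℤ) : toKey k ≠ ⊥ := WithBot.coe_ne_bot

theorem toKey_ne_top (k : ℤ) : toKey k ≠ ⊤ := by
  intro h
  have := WithBot.coe_injective
    (show ((k : WithTop ℤ) : WithBot (WithTop ℤ)) = ((⊤ : WithTop ℤ) : WithBot (WithTop ℤ)) from h)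
  exact WithTop.coe_ne_top this

theorem HeapStep.mark (I : HeapInv h P) (haP : a ∈ P) (hn : h a = some n)
    (hnext : n.next = (r, false)) (hk : n.key = toKey k) :
    HeapStep P (fun _ => False) h (h.write a { n with next := (r, true) }) := by
  have hR := reachable_mark hn hnext
  refine HeapStep.of_cas I haP hn (Node.mark_of_next hnext)
    -- An integer key excludes the sentinels, which must remain unmarked.
    (fun _ => hk ▸ ⟨toKey_ne_bot k, toKey_ne_top k⟩) ?_ (fun _ h => h.elim)
    (fun y hy => Or.inl ((hR y).1 hy)) (fun y m hy _ _ => (hR y).2 hy)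
  intro y hy
  have hnr := (Node.ref_of_next hnext).trans hy
  obtain ⟨m, hm⟩ := I.closed _ _ _ hn hnr
  exact ⟨m, hm, I.sorted _ _ _ _ hn hnr hm⟩

theorem mem_absSet_of_mark (I : HeapInv h P) (haP : a ∈ P) (hn : h a = some n)
    (hnext : n.next = (r, false)) (hk : n.key = toKey k) : k ∈ absSet h :=
  ⟨a, n, I.unmarked a haP n hn (Node.mark_of_next hnext), hn, Node.mark_of_next hnext, hk⟩

/-- No links change, and `a` is the only reachable node with key `k`, so hiding it removes `k`
altogether. -/
theorem absSet_mark (I : HeapInv h P) (haP : a ∈ P) (hn : h a = some n)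
    (hnext : n.next = (r, false)) (hk : n.key = toKey k) :
    absSet (h.write a { n with next := (r, true) }) = absSet h \ {k} := by
  have hR := reachable_mark hn hnext
  have hra := I.unmarked a haP n hn (Node.mark_of_next hnext)
  have ha' := Heap.write_self h a { n with next := (r, true) }
  ext i
  constructor
  · rintro ⟨y, m, hy, hm, hmm, hmk⟩
    rw [hR] at hy
    have hya : y ≠ a := by
      rintro rfl
      rw [ha'] at hm
      obtain rfl := Option.some.inj hm
      cases hmm
    rw [Heap.write_ne _ _ hya] at hm
    refine ⟨⟨y, m, hy, hm, hmm, hmk⟩, ?_⟩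
    rintro rfl
    exact hya (I.eq_of_key_eq hy hra hm hn hmk hk)
  · rintro ⟨⟨y, m, hy, hm, hmm, hmk⟩, hik⟩
    have hya : y ≠ a := by
      rintro rfl
      rw [hn] at hm
      obtain rfl := Option.some.inj hm
      exact hik (toKey_injective (hmk.symm.trans hk))
    exact ⟨y, m, (hR y).2 hy, (Heap.write_ne _ _ hya).trans hm, hmm, hmk⟩

end Mark

/-! ### The invariant of configurations -/

/-- The node at `x` has a key smaller than `k`. -/
def KeyLt (h : Heap) (x : Loc) (k : ℤ) : Prop := ∃ n, h x = some n ∧ n.key < toKey k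

/-- The invariant of the local variables of a thread, where `P` is the set of published nodes. -/
def PC.Inv (h : Heap) (P : Set Loc) : PC → Prop
  | .findNext _ k pred curr => pred ∈ P ∧ KeyLt h pred k ∧ ∀ x, curr = some x → x ∈ P
  | .findTest _ k pred curr succ marked => pred ∈ P ∧ KeyLt h pred k ∧ curr ∈ P ∧
      -- A marked field is frozen, so the pair read is still the present one; this makes the later
      -- unlinking correct. A successor read without a mark was reachable then, hence published.
      (marked = true → ∃ n, h curr = some n ∧ n.next = (succ, true)) ∧
      (marked = false → ∀ x, succ = some x → x ∈ P)
  | .found _ k pred curr => pred ∈ P ∧ KeyLt h pred k ∧ curr ∈ P ∧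
      ∃ n, h curr = some n ∧ toKey k ≤ n.key
  | .addNew k pred succ => pred ∈ P ∧ KeyLt h pred k ∧ succ ∈ P ∧
      ∃ n, h succ = some n ∧ toKey k < n.key
  | .addCas k pred succ _ => pred ∈ P ∧ KeyLt h pred k ∧ succ ∈ P ∧
      ∃ n, h succ = some n ∧ toKey k < n.key
  | .remRead k node => node ∈ P ∧ ∃ n, h node = some n ∧ n.key = toKey k
  | .remCas k node _ => node ∈ P ∧ ∃ n, h node = some n ∧ n.key = toKey k
  | .remReread k node _ => node ∈ P ∧ ∃ n, h node = some n ∧ n.key = toKey k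
  | _ => True

/-- `p` is about to publish the node at `x`, which is so far private. -/
def PC.Owns (p : PC) (x : Loc) : Prop := ∃ k pred succ, p = .addCas k pred succ x

namespace HeapStep

variable {h h' : Heap} {P : Set Loc} {X : Loc → Prop}

theorem exists_key (s : HeapStep P X h h') {x : Loc} {q : Key → Prop}
    (hx : ∃ n, h x = some n ∧ q n.key) : ∃ n, h' x = some n ∧ q n.key := by
  obtain ⟨n, hn, hq⟩ := hx
  obtain ⟨n', hn', hk, -⟩ := s.next x n hn
  exact ⟨n', hn', hk ▸ hq⟩

theorem keyLt (s : HeapStep P X h h') {x : Loc} {k : ℤ} (hx : KeyLt h x k) : KeyLt h' x k :=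
  s.exists_key (q := fun y => y < toKey k) hx

/-- The assertions of a thread survive steps of the other threads because they only mention
publication, keys and marked fields, all of which persist. -/
theorem pcInv (s : HeapStep P X h h') {p : PC} (hp : p.Inv h P) :
    p.Inv h' (P ∪ {x | Reachable h' x}) := by
  cases p with
  | findNext c k pred curr =>
    obtain ⟨h1, h2, h3⟩ := hp
    exact ⟨Or.inl h1, s.keyLt h2, fun x hx => Or.inl (h3 x hx)⟩
  | findTest c k pred curr succ marked =>
    obtain ⟨h1, h2, h3, h4, h5⟩ := hp
    refine ⟨Or.inl h1, s.keyLt h2, Or.inl h3, fun hm => ?_, fun hm x hx => Or.inl (h5 hm x hx)⟩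
    obtain ⟨n, hn, hnn⟩ := h4 hm
    obtain ⟨n', hn', -, hm', -⟩ := s.next _ n hn
    exact ⟨n', hn', (hm' (Node.mark_of_next hnn)).trans hnn⟩
  | found c k pred curr =>
    obtain ⟨h1, h2, h3, h4⟩ := hp
    exact ⟨Or.inl h1, s.keyLt h2, Or.inl h3, s.exists_key (q := fun y => toKey k ≤ y) h4⟩
  | addNew k pred succ =>
    obtain ⟨h1, h2, h3, h4⟩ := hp
    exact ⟨Or.inl h1, s.keyLt h2, Or.inl h3, s.exists_key (q := fun y => toKey k < y) h4⟩
  | addCas k pred succ x =>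
    obtain ⟨h1, h2, h3, h4⟩ := hp
    exact ⟨Or.inl h1, s.keyLt h2, Or.inl h3, s.exists_key (q := fun y => toKey k < y) h4⟩
  | remRead k node => exact ⟨Or.inl hp.1, s.exists_key (q := fun y => y = toKey k) hp.2⟩
  | remCas k node succ => exact ⟨Or.inl hp.1, s.exists_key (q := fun y => y = toKey k) hp.2⟩
  | remReread k node b => exact ⟨Or.inl hp.1, s.exists_key (q := fun y => y = toKey k) hp.2⟩
  | _ => trivial

end HeapStep

/-- The invariant of configurations, where `P` is the set of published nodes. -/
structure ConfigInv {T : Type*} (h : Heap) (P : Set Loc) (pc : T → PC) : Prop where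
  heap : HeapInv h P
  thread : ∀ t, (pc t).Inv h P
  priv : ∀ t k pred succ x, pc t = .addCas k pred succ x →
    x ∉ P ∧ h x = some ⟨toKey k, (some succ, false)⟩
  owner : ∀ t t' x, (pc t).Owns x → (pc t').Owns x → t = t'

/-! ### Effect of one atomic step on memory and on the invariants -/

section LocalStep

variable {h h' : Heap} {P : Set Loc}

theorem heapStep_addOk {k : ℤ} {pred succ x : Loc} (I : HeapInv h P)
    (hp : (PC.addCas k pred succ x).Inv h P) (hx : x ∉ P)
    (hxn : h x = some ⟨toKey k, (some succ, false)⟩)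
    (hc : CasOk h pred (some succ, false) (some x, false) h') :
    HeapStep P (fun y => y = x) h h' ∧ k ∉ absSet h ∧ absSet h' = insert k (absSet h) := by
  obtain ⟨h1, ⟨m, hm, hk⟩, h3, q, hq, hqk⟩ := hp
  obtain ⟨n, hn, hnn, rfl⟩ := hc
  rw [hn] at hm
  obtain rfl := Option.some.inj hm
  exact ⟨HeapStep.insert I h1 hn hnn hk hx hxn, notMem_absSet_of_gap I h1 hn hnn hk hq hqk,
    absSet_insert I h1 hn hnn hx hxn⟩

theorem heapStep_remCasOk {k : ℤ} {node : Loc} {succ : Ptr} (I : HeapInv h P)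
    (hp : (PC.remCas k node succ).Inv h P) (hc : CasOk h node (succ, false) (succ, true) h') :
    HeapStep P (fun _ => False) h h' ∧ k ∈ absSet h ∧ absSet h' = absSet h \ {k} := by
  obtain ⟨h1, m, hm, hk⟩ := hp
  obtain ⟨n, hn, hnn, rfl⟩ := hc
  rw [hn] at hm
  obtain rfl := Option.some.inj hm
  exact ⟨HeapStep.mark I h1 hn hnn hk, mem_absSet_of_mark I h1 hn hnn hk,
    absSet_mark I h1 hn hnn hk⟩

theorem heapStep_findSnip {c : Caller} {k : ℤ} {pred curr : Loc} {succ : Ptr} (I : HeapInv h P)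
    (hp : (PC.findTest c k pred curr succ true).Inv h P)
    (hc : CasOk h pred (some curr, false) (succ, false) h') :
    HeapStep P (fun _ => False) h h' ∧ absSet h' = absSet h ∧
      ∃ n, h' pred = some n ∧ n.next = (succ, false) := by
  obtain ⟨h1, -, -, h4, -⟩ := hp
  obtain ⟨q, hq, hqn⟩ := h4 rfl
  obtain ⟨n, hn, hnn, rfl⟩ := hc
  exact ⟨HeapStep.snip I h1 hn hnn hq hqn, absSet_snip I h1 hn hnn hq hqn,
    _, Heap.write_self _ _ _, rfl⟩

theorem heapStep_addNew {k : ℤ} {pred succ x : Loc} (I : HeapInv h P)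
    (hp : (PC.addNew k pred succ).Inv h P) (hx : h x = none) :
    HeapStep P (fun _ => False) h (h.write x ⟨toKey k, (some succ, false)⟩) ∧
      absSet (h.write x ⟨toKey k, (some succ, false)⟩) = absSet h := by
  obtain ⟨-, -, -, q, hq, hqk⟩ := hp
  exact ⟨HeapStep.alloc I hx hq hqk, absSet_alloc I hx⟩

theorem HeapInv.mem_of_ref (I : HeapInv h P) {x y : Loc} {n : Node} (hx : x ∈ P)
    (hn : h x = some n) (hm : n.mark = false) (hy : n.ref = some y) : y ∈ P :=
  I.reach y ((I.unmarked x hx n hn hm).step hn hy)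

/-- The effect of a local step on the memory, and on the invariant of the thread. -/
theorem LocalStep.heapStep {p p' : PC} {b : Option Act} (I : HeapInv h P) (hp : p.Inv h P)
    (hpriv : ∀ k pred succ x, p = .addCas k pred succ x →
      x ∉ P ∧ h x = some ⟨toKey k, (some succ, false)⟩)
    (s : LocalStep h p b h' p') :
    ∃ X, HeapStep P X h h' ∧ (∀ x, X x → p.Owns x) ∧
      p'.Inv h' (P ∪ {x | Reachable h' x}) ∧
      ∀ k pred succ x, p' = .addCas k pred succ x →
        h x = none ∧ h' x = some ⟨toKey k, (some succ, false)⟩ := by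
  -- Settles all steps that leave the memory alone; only unlinking, allocation and the two
  -- successful update CASes need separate treatment.
  have hsame : ∀ {q : PC}, q.Inv h P → (∀ k pred succ x, q ≠ .addCas k pred succ x) →
      ∃ X, HeapStep P X h h ∧ (∀ x, X x → p.Owns x) ∧
      q.Inv h (P ∪ {x | Reachable h x}) ∧
      ∀ k pred succ x, q = .addCas k pred succ x →
        h x = none ∧ h x = some ⟨toKey k, (some succ, false)⟩ := by
    intro q hq hne
    have s := HeapStep.refl I
    exact ⟨_, s, fun _ h => h.elim, s.pcInv hq, fun k pred succ x h => absurd h (hne _ _ _ _)⟩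
  cases s with
  | call op => refine hsame ?_ ?_ <;> cases op <;> simp [Op.start, PC.Inv]
  | ret r => exact hsame trivial (by simp)
  | findStart c k n hn =>
    refine hsame ⟨I.reach _ (reachable_head h), ?_, fun x hx => ?_⟩ (by simp)
    · obtain ⟨m, hm, hk, -⟩ := I.head
      exact ⟨m, hm, hk ▸ (bot_lt_iff_ne_bot.2 (toKey_ne_bot k))⟩
    · exact I.reach _ ((reachable_head h).step hn hx)
  | findNext c k pred curr n hn =>
    obtain ⟨h1, h2, h3⟩ := hp
    exact hsame ⟨h1, h2, h3 _ rfl, fun hm => ⟨n, hn, by rw [← hm]; rfl⟩,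
      fun hm x hx => I.mem_of_ref (h3 _ rfl) hn hm hx⟩ (by simp)
  | findSnip _ c k pred curr succ hc =>
    obtain ⟨s, -, n, hn, hnn⟩ := heapStep_findSnip I hp hc
    refine ⟨_, s, fun _ h => h.elim, ⟨Or.inl hp.1, s.keyLt hp.2.1, fun x hx => ?_⟩, by simp⟩
    exact s.inv.mem_of_ref (Or.inl hp.1) hn (Node.mark_of_next hnn)
      ((Node.ref_of_next hnn).trans hx)
  | findRestart c k pred curr succ hc => exact hsame trivial (by simp)
  | findAdvance c k pred curr succ n hn hk =>
    exact hsame ⟨hp.2.2.1, ⟨n, hn, hk⟩, hp.2.2.2.2 rfl⟩ (by simp)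
  | findReturn c k pred curr succ n hn hk =>
    exact hsame ⟨hp.1, hp.2.1, hp.2.2.1, n, hn, not_lt.1 hk⟩ (by simp)
  | addPresent k pred succ n hn hk => exact hsame trivial (by simp)
  | addAbsent k pred succ n hn hk =>
    obtain ⟨h1, h2, h3, m, hm, hle⟩ := hp
    rw [hn] at hm
    obtain rfl := Option.some.inj hm
    exact hsame ⟨h1, h2, h3, n, hn, lt_of_le_of_ne hle hk.symm⟩ (by simp)
  | addNew k pred succ x hx =>
    have s := (heapStep_addNew I hp hx).1
    refine ⟨_, s, fun _ h => h.elim, ?_, ?_⟩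
    · exact s.pcInv (p := .addCas k pred succ x) hp
    · rintro _ _ _ _ ⟨⟩
      exact ⟨hx, Heap.write_self _ _ _⟩
  | addOk _ k pred succ x hc =>
    obtain ⟨h1, h2⟩ := hpriv _ _ _ _ rfl
    refine ⟨_, (heapStep_addOk I hp h1 h2 hc).1, ?_, trivial, by simp⟩
    rintro _ rfl
    exact ⟨_, _, _, rfl⟩
  | addRestart k pred succ x hc => exact hsame trivial (by simp)
  | remAbsent k pred succ n hn hk => exact hsame trivial (by simp)
  | remPresent k pred succ n hn hk => exact hsame ⟨hp.2.2.1, n, hn, hk⟩ (by simp)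
  | remRead k node n hn => exact hsame hp (by simp)
  | remCasOk _ k node succ hc =>
    have s := (heapStep_remCasOk I hp hc).1
    exact ⟨_, s, fun _ h => h.elim, s.pcInv (p := .remReread k node true) hp, by simp⟩
  | remCasFail k node succ hc => exact hsame hp (by simp)
  | remMine k node n hn => exact hsame trivial (by simp)
  | remLost k node n hn hm => exact hsame trivial (by simp)
  | remRetry k node n hn hm => exact hsame hp (by simp)
  | remDone k pred curr => exact hsame trivial (by simp)
  | conStart k n hn => exact hsame trivial (by simp)
  | conEnter k curr succ marked n hn hk => exact hsame trivial (by simp)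
  | conLeave k curr succ marked n hn hk => exact hsame trivial (by simp)
  | conBody k curr succ marked n hn => exact hsame trivial (by simp)
  | conReturn k curr marked n hn => exact hsame trivial (by simp)

/-- The moving thread is handled by `LocalStep.heapStep`, the others by stability. Private nodes
stay private because a step can publish only a node owned by the mover, and a newly allocated
address differs from every node in use. -/
theorem ConfigInv.step {T : Type*} {pc pc' : T → PC} (I : ConfigInv h P pc) {t : T}
    {b : Option Act} (s : LocalStep h (pc t) b h' (pc' t)) (hne : ∀ t' ≠ t, pc' t' = pc t') :
    ConfigInv h' (P ∪ {x | Reachable h' x}) pc' ∧ ∃ X, HeapStep P X h h' := by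
  obtain ⟨X, hs, hX, hp, hnew⟩ := s.heapStep I.heap (I.thread t) (I.priv t)
  refine ⟨⟨hs.inv, fun t' => ?_, ?_, ?_⟩, X, hs⟩
  · by_cases ht : t' = t
    · subst ht; exact hp
    · rw [hne t' ht]; exact hs.pcInv (I.thread t')
  · intro t' k pred succ x hx
    by_cases ht : t' = t
    · subst ht
      obtain ⟨h1, h2⟩ := hnew _ _ _ _ hx
      have hxP : x ∉ P := fun hxP => by
        obtain ⟨n, hn⟩ := I.heap.alloc x hxP
        rw [h1] at hn; cases hn
      refine ⟨?_, h2⟩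
      rintro (hx' | hx')
      · exact hxP hx'
      · rcases hs.fresh x hx' with hx' | hx'
        · exact hxP (I.heap.reach x hx')
        -- A node published by this step was owned before it, hence already allocated, whereas `x`
        -- is fresh.
        · obtain ⟨_, _, _, hx'⟩ := hX x hx'
          have := (I.priv _ _ _ _ _ hx').2
          rw [h1] at this; cases this
    · rw [hne t' ht] at hx
      obtain ⟨h1, h2⟩ := I.priv _ _ _ _ _ hx
      refine ⟨?_, hs.frame _ _ h1 h2⟩
      rintro (hx' | hx')
      · exact h1 hx'
      · rcases hs.fresh x hx' with hx' | hx'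
        · exact h1 (I.heap.reach x hx')
        · exact ht (I.owner t' t x ⟨_, _, _, hx⟩ (hX x hx'))
  · have hcross : ∀ t', t' ≠ t → ∀ x, (pc' t).Owns x → ¬ (pc' t').Owns x := by
      rintro t' ht x ⟨_, _, _, h1⟩ ⟨_, _, _, h2⟩
      rw [hne t' ht] at h2
      have h3 := (I.priv _ _ _ _ _ h2).2
      rw [(hnew _ _ _ _ h1).1] at h3
      cases h3
    intro t₁ t₂ x h1 h2
    by_cases ht₁ : t₁ = t
    · subst ht₁
      by_contra hne'
      exact hcross t₂ (Ne.symm hne') x h1 h2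
    · by_cases ht₂ : t₂ = t
      · subst ht₂
        exact absurd h1 (hcross t₁ ht₁ x h2)
      · rw [hne t₁ ht₁] at h1
        rw [hne t₂ ht₂] at h2
        exact I.owner _ _ _ h1 h2

end LocalStep

/-! ### The initial configuration -/

theorem initHeap_head : initHeap head = some ⟨⊥, (some tail, false)⟩ := by
  simp [initHeap]

theorem initHeap_tail : initHeap tail = some ⟨⊤, (none, false)⟩ := by
  simp [initHeap, tail, head]

theorem initHeap_cases {x : Loc} {n : Node} (h : initHeap x = some n) :
    x = head ∧ n = ⟨⊥, (some tail, false)⟩ ∨ x = tail ∧ n = ⟨⊤, (none, false)⟩ := by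
  unfold initHeap at h
  split_ifs at h with h1 h2
  · exact Or.inl ⟨h1, (Option.some.inj h).symm⟩
  · exact Or.inr ⟨h2, (Option.some.inj h).symm⟩

theorem configInv_init {T : Type*} :
    ConfigInv initHeap {x | Reachable initHeap x} (fun _ : T => PC.idle) := by
  have htail : Reachable initHeap tail := (reachable_head _).step initHeap_head rfl
  refine ⟨⟨⟨_, initHeap_head, rfl, rfl⟩, ⟨_, initHeap_tail, rfl, rfl⟩, ?_, ?_, ?_,
    fun x hx => hx, fun x hx _ _ _ => hx, htail⟩, fun t => trivial, ?_, ?_⟩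
  · intro x y n m hn hr hm
    rcases initHeap_cases hn with ⟨rfl, rfl⟩ | ⟨rfl, rfl⟩
    · obtain rfl := Option.some.inj hr
      rw [initHeap_tail] at hm
      obtain rfl := Option.some.inj hm
      exact bot_lt_top
    · cases hr
  · intro x y n hn hr
    rcases initHeap_cases hn with ⟨rfl, rfl⟩ | ⟨rfl, rfl⟩
    · obtain rfl := Option.some.inj hr
      exact ⟨_, initHeap_tail⟩
    · cases hr
  · intro x hx
    rcases Relation.ReflTransGen.cases_tail hx with rfl | ⟨y, -, n, hn, hr⟩
    · exact ⟨_, initHeap_head⟩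
    · rcases initHeap_cases hn with ⟨rfl, rfl⟩ | ⟨rfl, rfl⟩
      · obtain rfl := Option.some.inj hr
        exact ⟨_, initHeap_tail⟩
      · cases hr
  · intro t k pred succ x hx
    cases hx
  · rintro t t' x ⟨_, _, _, hx⟩
    cases hx

/-! ### Invariants of executions -/

namespace Execution

variable {T : Type*} [DecidableEq T] (e : Execution T)

/-- The set of nodes published at time `j`. -/
def pub (j : ℕ) : Set Loc := {x | e.Published j x}

theorem pub_zero : e.pub 0 = {x | Reachable (e.heap 0) x} := by
  ext x
  simp [pub, Published]

theorem pub_succ (j : ℕ) : e.pub (j + 1) = e.pub j ∪ {x | Reachable (e.heap (j + 1)) x} := by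
  ext x
  constructor
  · rintro ⟨i, hi, hx⟩
    rcases Nat.le_succ_iff.1 hi with hi | rfl
    · exact Or.inl ⟨i, hi, hx⟩
    · exact Or.inr hx
  · rintro (⟨i, hi, hx⟩ | hx)
    · exact ⟨i, hi.trans (Nat.le_succ j), hx⟩
    · exact ⟨j + 1, le_rfl, hx⟩

theorem exists_localStep {i : ℕ} (hi : i < e.len) :
    ∃ t b, LocalStep (e.heap i) (e.pc i t) b (e.heap (i + 1)) (e.pc (i + 1) t) ∧
      (∀ t' ≠ t, e.pc (i + 1) t' = e.pc i t') ∧ e.lab i = b.map (fun x => (t, x)) := by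
  obtain ⟨t, b, p, hs, hp, hb⟩ := e.step i hi
  refine ⟨t, b, ?_, ?_, hb⟩
  · have : e.pc (i + 1) t = p := by simp [pc, hp]
    rw [this]
    exact hs
  · intro t' ht
    simp [pc, hp, ht]

/-- In each step, a given thread either moves, or keeps its control state. -/
theorem pc_succ_cases {i : ℕ} (hi : i < e.len) (t : T) :
    (∃ b, LocalStep (e.heap i) (e.pc i t) b (e.heap (i + 1)) (e.pc (i + 1) t) ∧
      e.lab i = b.map (fun x => (t, x))) ∨ e.pc (i + 1) t = e.pc i t := by
  obtain ⟨t', b, hs, hne, hb⟩ := e.exists_localStep hi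
  by_cases ht : t = t'
  · subst ht
    exact Or.inl ⟨b, hs, hb⟩
  · exact Or.inr (hne t ht)

theorem localStep_of_ne {i : ℕ} (hi : i < e.len) {t : T} (h : e.pc (i + 1) t ≠ e.pc i t) :
    ∃ b, LocalStep (e.heap i) (e.pc i t) b (e.heap (i + 1)) (e.pc (i + 1) t) ∧
      e.lab i = b.map (fun x => (t, x)) :=
  (e.pc_succ_cases hi t).resolve_right h

theorem configInv {j : ℕ} (hj : j ≤ e.len) : ConfigInv (e.heap j) (e.pub j) (e.pc j) := by
  induction j with
  | zero =>
    rw [pub_zero]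
    have h1 : e.heap 0 = initHeap := by simp [heap, e.init]
    have h2 : e.pc 0 = fun _ => .idle := by funext t; simp [pc, e.init]
    rw [h1, h2]
    exact configInv_init
  | succ j ih =>
    obtain ⟨t, b, hs, hne, -⟩ := e.exists_localStep (Nat.lt_of_succ_le hj)
    rw [pub_succ]
    exact ((ih (Nat.le_of_succ_le hj)).step hs hne).1

theorem heapInv {j : ℕ} (hj : j ≤ e.len) : HeapInv (e.heap j) (e.pub j) := (e.configInv hj).heap

theorem heapStep {i : ℕ} (hi : i < e.len) :
    ∃ X, HeapStep (e.pub i) X (e.heap i) (e.heap (i + 1)) := by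
  obtain ⟨t, b, hs, hne, -⟩ := e.exists_localStep hi
  exact ((e.configInv hi.le).step hs hne).2

/-- Keys and marked fields persist. -/
theorem node_persists {i j : ℕ} (hij : i ≤ j) (hj : j ≤ e.len) {x : Loc} {n : Node}
    (hn : e.heap i x = some n) :
    ∃ n', e.heap j x = some n' ∧ n'.key = n.key ∧ (n.mark = true → n'.next = n.next) := by
  induction j, hij using Nat.le_induction with
  | base => exact ⟨n, hn, rfl, fun _ => rfl⟩
  | succ j hij ih =>
    obtain ⟨m, hm, hk, hmm⟩ := ih (Nat.le_of_succ_le hj)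
    obtain ⟨X, s⟩ := e.heapStep (Nat.lt_of_succ_le hj)
    obtain ⟨m', hm', hk', hmm', -⟩ := s.next x m hm
    refine ⟨m', hm', hk'.trans hk, fun h => ?_⟩
    have h2 := hmm h
    exact (hmm' (by rw [Node.mark, h2]; exact h)).trans h2

/-- A node that is unmarked at time `i` and marked at time `j` is reachable and marked at some
time between them. -/
theorem exists_marking {i j : ℕ} (hij : i ≤ j) (hj : j ≤ e.len) {x : Loc} {n m : Node}
    (hn : e.heap i x = some n) (hu : n.mark = false) (hm : e.heap j x = some m)
    (hmm : m.mark = true) :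
    ∃ s, i < s ∧ s ≤ j ∧ Reachable (e.heap s) x ∧
      ∃ q, e.heap s x = some q ∧ q.key = m.key ∧ q.next = m.next := by
  induction j, hij using Nat.le_induction generalizing m with
  | base =>
    rw [hn] at hm
    obtain rfl := Option.some.inj hm
    rw [hu] at hmm; cases hmm
  | succ j hij ih =>
    obtain ⟨q, hq, -, -⟩ := e.node_persists hij (Nat.le_of_succ_le hj) hn
    obtain ⟨X, s⟩ := e.heapStep (Nat.lt_of_succ_le hj)
    obtain ⟨m', hm', hk, h1, h2⟩ := s.next x q hq
    rw [hm] at hm'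
    obtain rfl := Option.some.inj hm'
    cases hqm : q.mark with
    | false => exact ⟨j + 1, Nat.lt_succ_of_le hij, le_rfl, h2 hqm hmm, m, hm, rfl, rfl⟩
    -- The field was already marked at time `j` and is frozen since, so the earlier moment of
    -- marking still shows the present field.
    | true =>
      obtain ⟨s, hs1, hs2, hs3, r, hr, hrk, hrn⟩ := ih (Nat.le_of_succ_le hj) hq hqm
      exact ⟨s, hs1, hs2.trans (Nat.le_succ j), hs3, r, hr, hrk.trans hk.symm,
        hrn.trans (h1 hqm).symm⟩

/-! ### The effect of steps on the abstract set -/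

theorem absSet_addCas {i : ℕ} (hi : i < e.len) {t : T} {k : ℤ} {pred succ x : Loc}
    (h1 : e.pc i t = .addCas k pred succ x) (h2 : e.pc (i + 1) t = .ret true) :
    k ∉ absSet (e.heap i) ∧ absSet (e.heap (i + 1)) = insert k (absSet (e.heap i)) := by
  obtain ⟨b, hs, -⟩ := e.localStep_of_ne hi (t := t) (by rw [h1, h2]; simp)
  have I := e.configInv hi.le
  obtain ⟨h3, h4⟩ := I.priv _ _ _ _ _ h1
  have hp := I.thread t
  rw [h1] at hs hp
  rw [h2] at hs
  generalize e.heap (i + 1) = h' at hs ⊢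
  cases hs with
  | addOk _ _ _ _ _ hc => exact (heapStep_addOk I.heap hp h3 h4 hc).2

theorem absSet_remCas {i : ℕ} (hi : i < e.len) {t : T} {k : ℤ} {node : Loc} {succ : Ptr}
    (h1 : e.pc i t = .remCas k node succ) (h2 : e.pc (i + 1) t = .remReread k node true) :
    k ∈ absSet (e.heap i) ∧ absSet (e.heap (i + 1)) = absSet (e.heap i) \ {k} := by
  obtain ⟨b, hs, -⟩ := e.localStep_of_ne hi (t := t) (by rw [h1, h2]; simp)
  have I := e.configInv hi.le
  have hp := I.thread t
  rw [h1] at hs hp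
  rw [h2] at hs
  generalize e.heap (i + 1) = h' at hs ⊢
  cases hs with
  | remCasOk _ _ _ _ hc => exact (heapStep_remCasOk I.heap hp hc).2

/-- With the two update CASes excluded, only unlinking and allocation still write, and neither
affects the keys of reachable unmarked nodes. -/
theorem absSet_of_no_update {i : ℕ} (hi : i < e.len)
    (h1 : ¬ ∃ t k pred succ x, e.pc i t = .addCas k pred succ x ∧ e.pc (i + 1) t = .ret true)
    (h2 : ¬ ∃ t k node succ, e.pc i t = .remCas k node succ ∧
      e.pc (i + 1) t = .remReread k node true) :
    absSet (e.heap (i + 1)) = absSet (e.heap i) := by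
  obtain ⟨t, b, hs, -, -⟩ := e.exists_localStep hi
  have I := e.configInv hi.le
  have hp := I.thread t
  generalize hp1 : e.pc i t = p at hs hp
  generalize hp2 : e.pc (i + 1) t = p' at hs
  generalize he : e.heap (i + 1) = h' at hs ⊢
  cases hs with
  | findSnip _ c k pred curr succ hc => exact (heapStep_findSnip I.heap hp hc).2.1
  | addNew k pred succ x hx => exact (heapStep_addNew I.heap hp hx).2
  | addOk _ k pred succ x hc => exact absurd ⟨t, k, pred, succ, x, hp1, hp2⟩ h1
  | remCasOk _ k node succ hc => exact absurd ⟨t, k, node, succ, hp1, hp2⟩ h2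
  | _ => rfl

end Execution

namespace Execution

variable {T : Type*} [DecidableEq T] (e : Execution T)

/-! ### Properties of the past -/

section Past

variable {e} {t : T} {j : ℕ} {P Q : Heap → Prop}

theorem Past.now (h : e.pc j t ≠ .idle) (hP : P (e.heap j)) : e.Past t j P :=
  ⟨j, le_rfl, hP, fun m h1 h2 => by rwa [le_antisymm h2 h1]⟩

theorem Past.succ (hP : e.Past t j P) (h : e.pc (j + 1) t ≠ .idle) : e.Past t (j + 1) P := by
  obtain ⟨i, hi, hPi, hm⟩ := hP
  refine ⟨i, hi.trans (Nat.le_succ j), hPi, fun m h1 h2 => ?_⟩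
  rcases Nat.le_succ_iff.1 h2 with h2 | rfl
  · exact hm m h1 h2
  · exact h

theorem Past.mono (hP : e.Past t j P) (h : ∀ i ≤ j, P (e.heap i) → Q (e.heap i)) :
    e.Past t j Q := by
  obtain ⟨i, hi, hPi, hm⟩ := hP
  exact ⟨i, hi, h i hi hPi, hm⟩

/-- If `P` was true in the past, then so was everything that has been true since. -/
theorem Past.of_later (hP : e.Past t j P)
    (h : ∀ i ≤ j, P (e.heap i) → ∃ s, i ≤ s ∧ s ≤ j ∧ Q (e.heap s)) : e.Past t j Q := by
  obtain ⟨i, hi, hPi, hm⟩ := hP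
  obtain ⟨s, h1, h2, hQ⟩ := h i hi hPi
  exact ⟨s, h2, hQ, fun m h3 h4 => hm m (h1.trans h3) h4⟩

theorem PastFind.now (h : (e.pc j t).InFind) (hP : P (e.heap j)) : e.PastFind t j P :=
  ⟨j, le_rfl, hP, h, fun m h1 h2 => Or.inr (by rw [le_antisymm h2 h1])⟩

/-- If the thread is still inside `find` at time `j`, the window may end in whatever state follows,
such as the return of `find`; otherwise the thread must not move. -/
theorem PastFind.succ (hP : e.PastFind t j P)
    (h : (e.pc j t).InFind ∨ e.pc (j + 1) t = e.pc j t) : e.PastFind t (j + 1) P := by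
  obtain ⟨i, hi, hPi, hfi, hm⟩ := hP
  refine ⟨i, hi.trans (Nat.le_succ j), hPi, hfi, fun m h1 h2 => ?_⟩
  rcases Nat.le_succ_iff.1 h2 with h2 | rfl
  · rcases hm m h1 h2 with h3 | h3
    · exact Or.inl h3
    · rcases h with h | h
      · rw [h3]; exact Or.inl h
      · rw [h3, h]; exact Or.inr rfl
  · exact Or.inr rfl

theorem PastFind.mono (hP : e.PastFind t j P) (h : ∀ i ≤ j, P (e.heap i) → Q (e.heap i)) :
    e.PastFind t j Q := by
  obtain ⟨i, hi, hPi, hm⟩ := hP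
  exact ⟨i, hi, h i hi hPi, hm⟩

theorem PastFind.past (hP : e.PastFind t j P) (h : e.pc j t ≠ .idle) : e.Past t j P := by
  obtain ⟨i, hi, hPi, -, hm⟩ := hP
  refine ⟨i, hi, hPi, fun m h1 h2 => ?_⟩
  rcases hm m h1 h2 with h3 | h3
  · intro h4
    rw [h4] at h3
    exact h3
  · rwa [h3]

end Past

/-! ### Invariants that refer to the past -/

/-- What the local variables of a thread `t` in the control state `p` at time `j` say about
earlier times. -/
def TimeInv (t : T) (j : ℕ) : PC → Prop
  | .findNext _ _ pred curr =>
      e.PastFind t j (fun h => ∃ p, h pred = some p ∧ p.next = (curr, false) ∧ Reachable h pred)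
  | .findTest _ _ pred curr succ marked =>
      e.PastFind t j (fun h => ∃ p, h pred = some p ∧ p.next = (some curr, false) ∧
        Reachable h pred) ∧
      e.PastFind t j (fun h => ∃ q, h curr = some q ∧ q.next = (succ, marked) ∧
        (marked = false → Reachable h curr))
  | .found _ _ pred curr =>
      e.PastFind t j (fun h => ∃ p, h pred = some p ∧ p.next = (some curr, false) ∧
        Reachable h pred) ∧
      e.PastFind t j (fun h => ∃ q, h curr = some q ∧ q.mark = false ∧ Reachable h curr)
  | .remRead _ node => e.Past t j (fun h => ∃ n, h node = some n ∧ n.mark = false)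
  | .remCas _ node _ => e.Past t j (fun h => ∃ n, h node = some n ∧ n.mark = false)
  | .remReread _ node _ => e.Past t j (fun h => ∃ n, h node = some n ∧ n.mark = false)
  | .conTest k curr succ marked => e.Past t j (fun h => SearchPath h k curr ∧
      -- The guards reflect the limits of hindsight: the mark read is certified unless it is set on
      -- a node with key beyond `k`, and the whole field only for keys up to `k`.
      ∃ n, h curr = some n ∧ (n.key ≤ toKey k → n.next = (succ, marked)) ∧
        ((marked = true → n.key ≤ toKey k) → n.mark = marked))
  | .conBody k curr succ marked => e.Past t j (fun h => SearchPath h k curr ∧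
      ∃ n, h curr = some n ∧ n.key < toKey k ∧ n.next = (succ, marked))
  | .conExit k curr marked => (∃ n, e.heap j curr = some n ∧ toKey k ≤ n.key) ∧
      e.Past t j (fun h => SearchPath h k curr ∧
        ∃ n, h curr = some n ∧ ((marked = true → n.key = toKey k) → n.mark = marked))
  | _ => True

/-- For a thread at rest, statements about the past only see their window extended. The one
statement about the present, in `conExit`, concerns a key. -/
theorem TimeInv.succ {e : Execution T} {t : T} {j : ℕ} (hj : j < e.len)
    (hp : e.TimeInv t j (e.pc j t)) (h : e.pc (j + 1) t = e.pc j t) :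
    e.TimeInv t (j + 1) (e.pc (j + 1) t) := by
  rw [h]
  generalize hq : e.pc j t = q at hp
  rw [hq] at h
  have hF : ∀ P, e.PastFind t j P → e.PastFind t (j + 1) P :=
    fun P hP => hP.succ (Or.inr (h.trans hq.symm))
  have hP : q ≠ .idle → ∀ P, e.Past t j P → e.Past t (j + 1) P :=
    fun hne P hP => hP.succ (by rw [h]; exact hne)
  cases q with
  | findNext c k pred curr =>
    simp only [TimeInv] at hp ⊢
    exact hF _ hp
  | findTest c k pred curr succ marked =>
    simp only [TimeInv] at hp ⊢
    exact ⟨hF _ hp.1, hF _ hp.2⟩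
  | found c k pred curr =>
    simp only [TimeInv] at hp ⊢
    exact ⟨hF _ hp.1, hF _ hp.2⟩
  | remRead k node =>
    simp only [TimeInv] at hp ⊢
    exact hP (by simp) _ hp
  | remCas k node succ =>
    simp only [TimeInv] at hp ⊢
    exact hP (by simp) _ hp
  | remReread k node b =>
    simp only [TimeInv] at hp ⊢
    exact hP (by simp) _ hp
  | conTest k curr succ marked =>
    simp only [TimeInv] at hp ⊢
    exact hP (by simp) _ hp
  | conBody k curr succ marked =>
    simp only [TimeInv] at hp ⊢
    exact hP (by simp) _ hp
  | conExit k curr marked =>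
    simp only [TimeInv] at hp ⊢
    refine ⟨?_, hP (by simp) _ hp.2⟩
    obtain ⟨X, s⟩ := e.heapStep hj
    exact s.exists_key (q := fun y => toKey k ≤ y) hp.1
  | _ => trivial

/-- The hindsight argument for one iteration of the loop of `contains`: if `succ` was the successor
of a node on a search path at time `i`, and has the field `next` seen at time `j ≥ i`, then at some
time in between it was on a search path, with this field as far as it matters. -/
theorem hindsight {i j : ℕ} (hij : i ≤ j) (hj : j ≤ e.len) {k : ℤ} {x : Loc} {n : Node}
    (hx : SearchPath (e.heap i) k x) (hn : e.heap j x = some n) :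
    ∃ s, i ≤ s ∧ s ≤ j ∧ SearchPath (e.heap s) k x ∧ ∃ m, e.heap s x = some m ∧
      (m.key ≤ toKey k → m.next = n.next) ∧
      ((n.mark = true → m.key ≤ toKey k) → m.mark = n.mark) := by
  have Ii := e.heapInv (hij.trans hj)
  have Ij := e.heapInv hj
  obtain ⟨m, hm⟩ := Ii.alloc x (Ii.reach x hx.reachable)
  obtain ⟨n', hn', hkey, hmark⟩ := e.node_persists hij hj hm
  rw [hn] at hn'
  obtain rfl := Option.some.inj hn'
  by_cases hmm : m.mark = true
  -- Already marked at time `i`: the field is frozen, so `i` itself serves.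
  · have h := hmark hmm
    exact ⟨i, le_rfl, hij, hx, m, hm, fun _ => h.symm, fun _ => by simp [Node.mark, h]⟩
  · rw [Bool.not_eq_true] at hmm
    by_cases hk : m.key ≤ toKey k
    · have hnk : n.key ≤ toKey k := hkey ▸ hk
      cases hnm : n.mark with
      | false =>
        -- Still unmarked at time `j`: published and unmarked means reachable, so `j` serves.
        have hr := Ij.unmarked x ⟨i, hij, hx.reachable⟩ n hn hnm
        exact ⟨j, hij, le_rfl, Ij.searchPath hr n hn hnk, n, hn, fun _ => rfl, fun _ => hnm⟩
      | true =>
        -- Marked in between: the time right after the marking serves, the field being frozen from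
        -- then on.
        obtain ⟨s, h1, h2, h3, q, hq, hqk, hqn⟩ := e.exists_marking hij hj hm hmm hn hnm
        exact ⟨s, h1.le, h2, (e.heapInv (h2.trans hj)).searchPath h3 q hq (hqk ▸ hnk), q, hq,
          fun _ => hqn, fun _ => by rw [← hnm, Node.mark, hqn, Node.mark]⟩
    -- A key beyond `k`: later reachability would not yield a search path for `k`, so `i` is taken.
    -- The node is unmarked then, which agrees with the value read unless a mark was read; the guard
    -- exempts that case.
    · refine ⟨i, le_rfl, hij, hx, m, hm, fun h => absurd h hk, fun h => ?_⟩
      rw [hmm]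
      cases hnm : n.mark with
      | false => rfl
      | true => exact absurd (h hnm) hk

theorem timeInv {j : ℕ} (hj : j ≤ e.len) (t : T) : e.TimeInv t j (e.pc j t) := by
  induction j with
  | zero =>
    have : e.pc 0 t = .idle := by simp [pc, e.init]
    rw [this]
    trivial
  | succ j ih =>
    have hp := ih (Nat.le_of_succ_le hj)
    have hjl := Nat.lt_of_succ_le hj
    rcases e.pc_succ_cases hjl t with ⟨b, hs, -⟩ | h
    swap
    · exact hp.succ hjl h
    have I := e.configInv hjl.le
    have I' := e.configInv hj
    have hpc := I.thread t
    have hP : e.pc (j + 1) t ≠ .idle → ∀ P, e.Past t j P → e.Past t (j + 1) P :=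
      fun hne P hP => hP.succ hne
    have hF : (e.pc j t).InFind → ∀ P, e.PastFind t j P → e.PastFind t (j + 1) P :=
      fun hf P hP => hP.succ (Or.inl hf)
    have hnow : (e.pc j t).InFind → ∀ P : Heap → Prop, P (e.heap j) → e.PastFind t (j + 1) P :=
      fun hf P hP => (PastFind.now hf hP).succ (Or.inl hf)
    generalize hp1 : e.pc j t = p at hs hp hpc hF hnow
    generalize hp2 : e.pc (j + 1) t = p' at hs hP ⊢
    generalize he1 : e.heap j = h at hs
    generalize he2 : e.heap (j + 1) = h' at hs
    cases hs with
    | findStart c k n hn =>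
      simp only [TimeInv] at ⊢
      rw [← he1] at hn
      obtain ⟨m, hm, -, hmm⟩ := I.heap.head
      rw [hn] at hm
      obtain rfl := Option.some.inj hm
      exact hnow trivial _ ⟨n, hn, by rw [← hmm]; rfl, reachable_head _⟩
    | findNext c k pred curr n hn =>
      simp only [TimeInv] at hp ⊢
      rw [← he1] at hn
      exact ⟨hF trivial _ hp, hnow trivial _ ⟨n, hn, rfl,
        fun hm => I.heap.unmarked _ (hpc.2.2 _ rfl) n hn hm⟩⟩
    | findSnip _ c k pred curr succ hc =>
      simp only [TimeInv] at ⊢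
      rw [← he1] at hc
      obtain ⟨-, -, n, hn, hnn⟩ := heapStep_findSnip I.heap hpc hc
      rw [← he2] at hn
      -- The required moment is right after the CAS, when `pred` is unmarked and points to `succ`.
      refine PastFind.now (by rw [hp2]; trivial) ⟨n, hn, hnn, ?_⟩
      refine I'.heap.unmarked _ ?_ n hn (Node.mark_of_next hnn)
      rw [pub_succ]
      exact Or.inl hpc.1
    | findAdvance c k pred curr succ n hn hk =>
      simp only [TimeInv] at hp ⊢
      -- The earlier reading of the unmarked `curr` becomes the assertion about the new `pred`.
      refine (hF trivial _ hp.2).mono ?_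
      rintro i - ⟨q, hq, hqn, hr⟩
      exact ⟨q, hq, hqn, hr trivial⟩
    | findReturn c k pred curr succ n hn hk =>
      simp only [TimeInv] at hp ⊢
      refine ⟨hF trivial _ hp.1, (hF trivial _ hp.2).mono ?_⟩
      rintro i - ⟨q, hq, hqn, hr⟩
      exact ⟨q, hq, Node.mark_of_next hqn, hr trivial⟩
    | remPresent k pred succ n hn hk =>
      simp only [TimeInv] at hp ⊢
      refine hP (by simp) _ ((hp.2.past (by rw [hp1]; simp)).mono ?_)
      rintro i - ⟨q, hq, hqm, -⟩
      exact ⟨q, hq, hqm⟩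
    | remRead k node n hn =>
      simp only [TimeInv] at hp ⊢
      exact hP (by simp) _ hp
    | remCasOk _ k node succ hc =>
      simp only [TimeInv] at hp ⊢
      exact hP (by simp) _ hp
    | remCasFail k node succ hc =>
      simp only [TimeInv] at hp ⊢
      exact hP (by simp) _ hp
    | remRetry k node n hn hm =>
      simp only [TimeInv] at hp ⊢
      exact hP (by simp) _ hp
    | conStart k n hn =>
      simp only [TimeInv] at ⊢
      rw [← he1] at hn
      obtain ⟨m, hm, -, hmm⟩ := I.heap.head
      rw [hn] at hm
      obtain rfl := Option.some.inj hm
      exact hP (by simp) _ (Past.now (by rw [hp1]; simp)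
        ⟨Relation.ReflTransGen.refl, n, hn, fun _ => by rw [← hmm]; rfl, fun _ => hmm⟩)
    | conEnter k curr succ marked n hn hk =>
      simp only [TimeInv] at hp ⊢
      refine hP (by simp) _ (hp.mono ?_)
      rintro i hi ⟨h1, m, hm, h2, -⟩
      obtain ⟨n', hn', hk', -⟩ := e.node_persists hi hjl.le hm
      rw [he1, hn] at hn'
      obtain rfl := Option.some.inj hn'
      rw [hk'] at hk
      exact ⟨h1, m, hm, hk, h2 hk.le⟩
    | conLeave k curr succ marked n hn hk =>
      simp only [TimeInv] at hp ⊢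
      refine ⟨⟨n, by rw [he2]; exact hn, not_lt.1 hk⟩, hP (by simp) _ (hp.mono ?_)⟩
      rintro i hi ⟨h1, m, hm, -, h2⟩
      exact ⟨h1, m, hm, fun h => h2 fun h3 => (h h3).le⟩
    | conBody k curr succ marked n hn =>
      simp only [TimeInv] at hp ⊢
      rw [← he1] at hn
      refine hP (by simp) _ (hp.of_later ?_)
      rintro i hi ⟨h1, m, hm, h2, h3⟩
      -- At the past time, `curr` was on the search path with a key below `k` and pointed to `succ`;
      -- so `succ` was on it too, and hindsight starts there.
      exact e.hindsight hi hjl.le (h1.step hm (Node.ref_of_next h3) h2) hn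
    | call op => cases op <;> trivial
    | _ => trivial

end Execution

/-! ### Operations in progress -/

/-- The operation on whose behalf `find` is executed. -/
def Caller.op (c : Caller) (k : ℤ) : Op :=
  match c with
  | .add => .add k
  | .remove => .remove k
  | .cleanup => .remove k

/-- The operation that a thread is executing, as far as its control state reveals it. -/
def PC.op? : PC → Option Op
  | .findStart c k => some (c.op k)
  | .findNext c k _ _ => some (c.op k)
  | .findTest c k _ _ _ _ => some (c.op k)
  | .found c k _ _ => some (c.op k)
  | .addNew k _ _ => some (.add k)
  | .addCas k _ _ _ => some (.add k)
  | .remRead k _ => some (.remove k)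
  | .remCas k _ _ => some (.remove k)
  | .remReread k _ _ => some (.remove k)
  | .conStart k => some (.contains k)
  | .conTest k _ _ _ => some (.contains k)
  | .conBody k _ _ _ => some (.contains k)
  | .conExit k _ _ => some (.contains k)
  | _ => none

/-- The control states of `remove` after its successful `CAS`. -/
def PC.Marked : PC → Prop
  | .remReread _ _ b => b = true
  | .findStart c _ => c = .cleanup
  | .findNext c _ _ _ => c = .cleanup
  | .findTest c _ _ _ _ _ => c = .cleanup
  | .found c _ _ _ => c = .cleanup
  | _ => False

namespace LocalStep

variable {h h' : Heap} {p p' : PC} {b : Option Act}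

theorem of_call {op : Op} (s : LocalStep h p (some (.call op)) h' p') :
    p = .idle ∧ p' = op.start := by
  cases s with
  | call op => exact ⟨rfl, rfl⟩

theorem of_ret {r : Bool} (s : LocalStep h p (some (.ret r)) h' p') :
    p = .ret r ∧ p' = .idle := by
  cases s with
  | ret r => exact ⟨rfl, rfl⟩

theorem of_idle (s : LocalStep h .idle b h' p') : ∃ op, b = some (.call op) := by
  cases s with
  | call op => exact ⟨op, rfl⟩

theorem to_idle (s : LocalStep h p b h' .idle) : ∃ r, b = some (.ret r) := by
  generalize hp : PC.idle = q at s
  cases s with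
  | ret r => exact ⟨r, rfl⟩
  | call op => cases op <;> cases hp
  | _ => cases hp

/-- After a successful update, a thread can only return `true`. -/
theorem updated (s : LocalStep h p b h' p') (hp : p.Marked ∨ p = .ret true) (hi : p' ≠ .idle) :
    p'.Marked ∨ p' = .ret true := by
  cases s <;> simp_all [PC.Marked]

end LocalStep

/-! ### Operation intervals, update steps and read points -/

namespace Execution

variable {T : Type*} [DecidableEq T] (e : Execution T)

/-- In step `i`, the thread `t` performs the successful `CAS` of the update operation `op`. -/
def Updates (i : ℕ) (t : T) : Op → Prop
  | .add k => ∃ pred succ x, e.pc i t = .addCas k pred succ x ∧ e.pc (i + 1) t = .ret true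
  | .remove k => ∃ node succ, e.pc i t = .remCas k node succ ∧
      e.pc (i + 1) t = .remReread k node true
  | .contains _ => False

/-- At time `j`, the thread `t` is executing the operation `op`, which it invoked in step `c`. -/
def Span (c j : ℕ) (t : T) (op : Op) : Prop :=
  e.lab c = some (t, .call op) ∧ c < j ∧ j ≤ e.len ∧ ∀ m, c < m → m ≤ j → e.pc m t ≠ .idle

/-- At some time after step `c` up to time `j`, the abstract set is such that `op` returns `r` and
changes nothing. -/
def ReadPoint (c j : ℕ) (op : Op) (r : Bool) : Prop :=
  ∃ i, c < i ∧ i ≤ j ∧ (r = true ↔ op.Succeeds (absSet (e.heap i))) ∧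
    op.next (absSet (e.heap i)) = absSet (e.heap i)

variable {e}

theorem localStep_of_lab {i : ℕ} (hi : i < e.len) {t : T} {a : Act} (h : e.lab i = some (t, a)) :
    LocalStep (e.heap i) (e.pc i t) (some a) (e.heap (i + 1)) (e.pc (i + 1) t) := by
  obtain ⟨t', b, hs, -, hb⟩ := e.exists_localStep hi
  rw [h] at hb
  cases b with
  | none => cases hb
  | some b =>
    obtain ⟨rfl, rfl⟩ := Prod.mk.inj (Option.some.inj hb)
    exact hs

theorem lab_of_idle {i : ℕ} (hi : i < e.len) {t : T} (h : e.pc i t = .idle)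
    (h' : e.pc (i + 1) t ≠ .idle) : ∃ op, e.lab i = some (t, .call op) := by
  obtain ⟨b, hs, hb⟩ := e.localStep_of_ne hi (t := t) (by rwa [h])
  rw [h] at hs
  obtain ⟨op, rfl⟩ := hs.of_idle
  exact ⟨op, hb⟩

theorem lab_of_to_idle {i : ℕ} (hi : i < e.len) {t : T} (h : e.pc i t ≠ .idle)
    (h' : e.pc (i + 1) t = .idle) : ∃ r, e.lab i = some (t, .ret r) := by
  obtain ⟨b, hs, hb⟩ := e.localStep_of_ne hi (t := t) (by rw [h']; exact h.symm)
  rw [h'] at hs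
  obtain ⟨r, rfl⟩ := hs.to_idle
  exact ⟨r, hb⟩

theorem exists_span {j : ℕ} (hj : j ≤ e.len) {t : T} (h : e.pc j t ≠ .idle) :
    ∃ c op, e.Span c j t op := by
  induction j with
  | zero => exact absurd (by simp [pc, e.init]) h
  | succ j ih =>
    by_cases h' : e.pc j t = .idle
    · obtain ⟨op, hop⟩ := lab_of_idle (Nat.lt_of_succ_le hj) h' h
      refine ⟨j, op, hop, Nat.lt_succ_self j, hj, fun m h1 h2 => ?_⟩
      rwa [le_antisymm h2 h1]
    · obtain ⟨c, op, h1, h2, h3, h4⟩ := ih (Nat.le_of_succ_le hj) h'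
      refine ⟨c, op, h1, h2.trans (Nat.lt_succ_self j), hj, fun m h5 h6 => ?_⟩
      rcases Nat.le_succ_iff.1 h6 with h6 | rfl
      · exact h4 m h5 h6
      · exact h

namespace Span

variable {c j : ℕ} {t : T} {op : Op}

theorem idle (s : e.Span c j t op) : e.pc c t = .idle :=
  (localStep_of_lab (s.2.1.trans_le s.2.2.1) s.1).of_call.1

theorem start (s : e.Span c j t op) : e.pc (c + 1) t = op.start :=
  (localStep_of_lab (s.2.1.trans_le s.2.2.1) s.1).of_call.2

theorem anti {i : ℕ} (s : e.Span c j t op) (hi : c < i) (hij : i ≤ j) : e.Span c i t op :=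
  ⟨s.1, hi, hij.trans s.2.2.1, fun m h1 h2 => s.2.2.2 m h1 (h2.trans hij)⟩

/-- The thread is idle at the invocation step, so a witness reached without idling lies strictly
after it. -/
theorem past {P : Heap → Prop} (s : e.Span c j t op) (hP : e.Past t j P) :
    ∃ i, c < i ∧ i ≤ j ∧ P (e.heap i) := by
  obtain ⟨i, hi, hPi, hm⟩ := hP
  refine ⟨i, ?_, hi, hPi⟩
  by_contra hc
  exact hm c (not_lt.1 hc) s.2.1.le s.idle

/-- The invocation of the operation in progress is determined by the time and the thread. -/
theorem unique {c' : ℕ} {op' : Op} (s : e.Span c j t op) (s' : e.Span c' j t op') :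
    c = c' ∧ op = op' := by
  have hcc : c = c' := by
    rcases lt_trichotomy c c' with h | h | h
    · exact absurd s'.idle (s.2.2.2 c' h s'.2.1.le)
    · exact h
    · exact absurd s.idle (s'.2.2.2 c h s.2.1.le)
  subst hcc
  have h := s.1.symm.trans s'.1
  cases h
  exact ⟨rfl, rfl⟩

end Span

/-- The update leads from a state not yet counted as updated into one that is; together with
`Updates.later` this forbids a second update in the same operation. -/
theorem Updates.pc_ne {i : ℕ} {t : T} {op : Op} (u : e.Updates i t op) :
    e.pc i t ≠ .idle ∧ e.pc (i + 1) t ≠ .idle ∧ e.pc (i + 1) t ≠ e.pc i t ∧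
      ¬ ((e.pc i t).Marked ∨ e.pc i t = .ret true) ∧ (∀ r, e.pc i t ≠ .ret r) ∧
      ((e.pc (i + 1) t).Marked ∨ e.pc (i + 1) t = .ret true) := by
  cases op with
  | add k =>
    obtain ⟨pred, succ, x, h1, h2⟩ := u
    simp [h1, h2, PC.Marked]
  | remove k =>
    obtain ⟨node, succ, h1, h2⟩ := u
    simp [h1, h2, PC.Marked]
  | contains k => exact u.elim

theorem Updates.later {i j : ℕ} {t : T} {op : Op} (u : e.Updates i t op) (hij : i < j)
    (hj : j ≤ e.len) (hne : ∀ m, i < m → m ≤ j → e.pc m t ≠ .idle) :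
    (e.pc j t).Marked ∨ e.pc j t = .ret true := by
  induction j, hij using Nat.le_induction with
  | base => exact u.pc_ne.2.2.2.2.2
  | succ j hij ih =>
    have h := ih (Nat.le_of_succ_le hj) fun m h1 h2 => hne m h1 (h2.trans (Nat.le_succ j))
    rcases e.pc_succ_cases (Nat.lt_of_succ_le hj) t with ⟨b, hs, -⟩ | h'
    · exact hs.updated h (hne _ (Nat.lt_succ_of_lt hij) le_rfl)
    · rwa [h']

theorem Updates.unique_thread {i : ℕ} (hi : i < e.len) {t t' : T} {op op' : Op}
    (u : e.Updates i t op) (u' : e.Updates i t' op') : t = t' := by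
  obtain ⟨t₀, b, -, hne, -⟩ := e.exists_localStep hi
  have h1 : t = t₀ := by
    by_contra h; exact u.pc_ne.2.2.1 (hne t h)
  have h2 : t' = t₀ := by
    by_contra h; exact u'.pc_ne.2.2.1 (hne t' h)
  rw [h1, h2]

theorem Updates.absSet_succ {i : ℕ} (hi : i < e.len) {t : T} {op : Op} (u : e.Updates i t op) :
    op.Succeeds (absSet (e.heap i)) ∧ absSet (e.heap (i + 1)) = op.next (absSet (e.heap i)) := by
  cases op with
  | add k =>
    obtain ⟨pred, succ, x, h1, h2⟩ := u
    exact e.absSet_addCas hi h1 h2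
  | remove k =>
    obtain ⟨node, succ, h1, h2⟩ := u
    exact e.absSet_remCas hi h1 h2
  | contains k => exact u.elim

theorem absSet_eq_of_not_updates {i : ℕ} (hi : i < e.len) (h : ¬ ∃ t op, e.Updates i t op) :
    absSet (e.heap (i + 1)) = absSet (e.heap i) := by
  refine e.absSet_of_no_update hi ?_ ?_
  · rintro ⟨t, k, pred, succ, x, h1, h2⟩
    exact h ⟨t, .add k, pred, succ, x, h1, h2⟩
  · rintro ⟨t, k, node, succ, h1, h2⟩
    exact h ⟨t, .remove k, node, succ, h1, h2⟩

/-! ### Linearization points of operations that do not change the set -/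

section ReadPoints

variable {c j : ℕ} {t : T}

/-- The moment is the one during `find` at which `curr`, whose key is `k`, was reachable and
unmarked. -/
theorem readPoint_addPresent {k : ℤ} {pred curr : Loc} (s : e.Span c j t (.add k)) {n : Node}
    (h : e.pc j t = .found .add k pred curr) (hn : e.heap j curr = some n)
    (hk : n.key = toKey k) : e.ReadPoint c j (.add k) false := by
  have hj := s.2.2.1
  have ht := e.timeInv hj t
  rw [h] at ht
  obtain ⟨i, hci, hij, q, hq, hqm, hqr⟩ := s.past (ht.2.past (by rw [h]; simp))
  obtain ⟨n', hn', hk', -⟩ := e.node_persists hij hj hq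
  rw [hn] at hn'
  obtain rfl := Option.some.inj hn'
  have hmem : k ∈ absSet (e.heap i) := ⟨curr, q, hqr, hq, hqm, hk'.symm.trans hk⟩
  exact ⟨i, hci, hij, by simp [Op.Succeeds, hmem], Set.insert_eq_of_mem hmem⟩

/-- The moment is the one at which the unmarked `pred` pointed to `curr`: their keys lie on both
sides of `k`, strictly, and nothing fits between them. -/
theorem readPoint_remAbsent {k : ℤ} {pred curr : Loc} (s : e.Span c j t (.remove k)) {n : Node}
    (h : e.pc j t = .found .remove k pred curr) (hn : e.heap j curr = some n)
    (hk : n.key ≠ toKey k) : e.ReadPoint c j (.remove k) false := by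
  have hj := s.2.2.1
  have ht := e.timeInv hj t
  have hp := (e.configInv hj).thread t
  rw [h] at ht hp
  obtain ⟨-, ⟨p, hp, hpk⟩, -, n', hn', hnk⟩ := hp
  rw [hn] at hn'
  obtain rfl := Option.some.inj hn'
  obtain ⟨i, hci, hij, q, hq, hqn, hqr⟩ := s.past (ht.1.past (by rw [h]; simp))
  have I := e.heapInv (hij.trans hj)
  obtain ⟨p', hp', hkq, -⟩ := e.node_persists hij hj hq
  rw [hp] at hp'
  obtain rfl := Option.some.inj hp'
  obtain ⟨m, hm⟩ := I.closed _ _ _ hq (Node.ref_of_next hqn)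
  obtain ⟨m', hm', hkm, -⟩ := e.node_persists hij hj hm
  rw [hn] at hm'
  obtain rfl := Option.some.inj hm'
  rw [hkq] at hpk
  rw [hkm] at hnk hk
  have hmem : k ∉ absSet (e.heap i) := notMem_absSet_of_gap I (I.reach _ hqr) hq hqn hpk hm
    (lt_of_le_of_ne hnk hk.symm)
  exact ⟨i, hci, hij, by simp [Op.Succeeds, hmem], Set.sdiff_singleton_eq_self hmem⟩

/-- The node was unmarked earlier in this operation, so it has been marked since. Right after the
marking it is reachable and marked with key `k`, which excludes another node with that key. -/
theorem readPoint_remLost {k : ℤ} {node : Loc} (s : e.Span c j t (.remove k)) {n : Node}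
    (h : e.pc j t = .remReread k node false) (hn : e.heap j node = some n)
    (hm : n.mark = true) : e.ReadPoint c j (.remove k) false := by
  have hj := s.2.2.1
  have ht := e.timeInv hj t
  have hp := (e.configInv hj).thread t
  rw [h] at ht hp
  simp only [TimeInv] at ht
  obtain ⟨-, n', hn', hk⟩ := hp
  rw [hn] at hn'
  obtain rfl := Option.some.inj hn'
  obtain ⟨i, hci, hij, q, hq, hqm⟩ := s.past ht
  obtain ⟨l, hil, hlj, hr, m, hml, hmk, hmn⟩ := e.exists_marking hij hj hq hqm hn hm
  have I := e.heapInv (hlj.trans hj)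
  have hkm : m.key = toKey k := hmk.trans hk
  have hmem : k ∉ absSet (e.heap l) :=
    I.notMem_absSet (I.searchPath hr m hml hkm.le) hml hkm.ge
      (fun _ => by rw [← hm, Node.mark, hmn, Node.mark])
  exact ⟨l, hci.trans hil, hlj, by simp [Op.Succeeds, hmem], Set.sdiff_singleton_eq_self hmem⟩

/-- The moment is the one provided by hindsight: `curr` ends a search path for `k` there, so it
alone decides whether `k` is present. -/
theorem readPoint_contains {k : ℤ} {curr : Loc} {marked : Bool} (s : e.Span c j t (.contains k))
    {n : Node} (h : e.pc j t = .conExit k curr marked) (hn : e.heap j curr = some n) :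
    e.ReadPoint c j (.contains k) (decide (n.key = toKey k) && !marked) := by
  have hj := s.2.2.1
  have ht := e.timeInv hj t
  rw [h] at ht
  obtain ⟨⟨n', hn', hk⟩, ht⟩ := ht
  rw [hn] at hn'
  obtain rfl := Option.some.inj hn'
  obtain ⟨i, hci, hij, hs, m, hm, hmm⟩ := s.past ht
  have I := e.heapInv (hij.trans hj)
  obtain ⟨n', hn', hkm, -⟩ := e.node_persists hij hj hm
  rw [hn] at hn'
  obtain rfl := Option.some.inj hn'
  refine ⟨i, hci, hij, ?_, rfl⟩
  simp only [Op.Succeeds, Bool.and_eq_true, decide_eq_true_eq, Bool.not_eq_true']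
  constructor
  · rintro ⟨h1, rfl⟩
    exact ⟨curr, m, hs.reachable, hm, hmm (by simp), hkm.symm.trans h1⟩
  · intro hmem
    by_contra hcon
    -- Agreement of the marks is available only under its guard. Here equality of keys supplies it;
    -- in the other direction nothing was read as marked.
    refine I.notMem_absSet hs hm (hkm ▸ hk) (fun h1 => ?_) hmem
    rw [hmm fun _ => h1]
    have h2 := hkm.trans h1
    by_contra h3
    exact hcon ⟨h2, by simpa using h3⟩

end ReadPoints

/-- What the control state of a thread says about the operation in progress. -/
theorem Span.info {c j : ℕ} {t : T} {op : Op} (s : e.Span c j t op) :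
    (∀ op', (e.pc j t).op? = some op' → op' = op) ∧
    ((e.pc j t).Marked → ∃ i, c < i ∧ i < j ∧ e.Updates i t op) ∧
    (∀ r, e.pc j t = .ret r →
      (∃ i, c < i ∧ i < j ∧ e.Updates i t op) ∨ e.ReadPoint c j op r) := by
  obtain ⟨k, rfl⟩ := Nat.exists_eq_add_of_lt s.2.1
  induction k with
  | zero =>
    rw [add_zero] at s ⊢
    rw [s.start]
    cases op <;> simp [Op.start, PC.op?, PC.Marked, Caller.op]
  | succ k ih =>
    have hcj : c < c + k + 1 := by omega
    have sj : e.Span c (c + k + 1) t op := s.anti hcj (by omega)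
    have ih := ih sj
    have hs' := s.2.2.2 (c + (k + 1) + 1) s.2.1 le_rfl
    rw [← add_assoc] at s hs' ⊢
    generalize c + k + 1 = j at *
    have hjl : j < e.len := s.2.2.1
    obtain ⟨ih1, ih2, ih3⟩ := ih
    have hUpd : (∃ i, c < i ∧ i < j ∧ e.Updates i t op) →
        ∃ i, c < i ∧ i < j + 1 ∧ e.Updates i t op :=
      fun ⟨i, h1, h2, h3⟩ => ⟨i, h1, h2.trans (Nat.lt_succ_self j), h3⟩
    have hRead : ∀ {r}, e.ReadPoint c j op r → e.ReadPoint c (j + 1) op r :=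
      fun ⟨i, h1, h2, h3⟩ => ⟨i, h1, h2.trans (Nat.le_succ j), h3⟩
    rcases e.pc_succ_cases hjl t with ⟨b, hs, -⟩ | h
    swap
    · rw [h]
      exact ⟨ih1, fun hm => hUpd (ih2 hm), fun r hr => (ih3 r hr).imp hUpd hRead⟩
    generalize hp1 : e.pc j t = p at hs ih1 ih2
    generalize hp2 : e.pc (j + 1) t = p' at hs hs' ⊢
    generalize he1 : e.heap j = h at hs
    generalize he2 : e.heap (j + 1) = h' at hs
    cases hs with
    | call op => exact absurd hp1 (sj.2.2.2 j hcj le_rfl)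
    | ret r => exact absurd rfl hs'
    | addPresent k pred curr n hn hk =>
      obtain rfl := ih1 _ rfl
      rw [← he1] at hn
      refine ⟨by simp [PC.op?], fun h => h.elim, ?_⟩
      rintro r ⟨⟩
      exact Or.inr (hRead (readPoint_addPresent sj hp1 hn hk))
    | addOk _ k pred succ x hc =>
      obtain rfl := ih1 _ rfl
      refine ⟨by simp [PC.op?], fun h => h.elim, ?_⟩
      rintro r ⟨⟩
      exact Or.inl ⟨j, hcj, Nat.lt_succ_self j, pred, succ, x, hp1, hp2⟩
    | remAbsent k pred curr n hn hk =>
      obtain rfl := ih1 _ rfl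
      rw [← he1] at hn
      refine ⟨by simp [PC.op?], fun h => h.elim, ?_⟩
      rintro r ⟨⟩
      exact Or.inr (hRead (readPoint_remAbsent sj hp1 hn hk))
    | remCasOk _ k node succ hc =>
      obtain rfl := ih1 _ rfl
      exact ⟨ih1, fun _ => ⟨j, hcj, Nat.lt_succ_self j, node, succ, hp1, hp2⟩, by simp⟩
    | remLost k node n hn hm =>
      obtain rfl := ih1 _ rfl
      rw [← he1] at hn
      refine ⟨by simp [PC.op?], fun h => h.elim, ?_⟩
      rintro r ⟨⟩
      exact Or.inr (hRead (readPoint_remLost sj hp1 hn hm))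
    | remDone k pred curr =>
      refine ⟨by simp [PC.op?], fun h => h.elim, fun r _ => Or.inl (hUpd (ih2 rfl))⟩
    | conReturn k curr marked n hn =>
      obtain rfl := ih1 _ rfl
      rw [← he1] at hn
      refine ⟨by simp [PC.op?], fun h => h.elim, ?_⟩
      rintro r ⟨⟩
      exact Or.inr (hRead (readPoint_contains sj hp1 hn))
    | remMine k node n hn => exact ⟨ih1, fun _ => hUpd (ih2 rfl), by simp⟩
    | findStart cl k n hn => exact ⟨ih1, fun hm => hUpd (ih2 hm), by simp⟩
    | findNext cl k pred curr n hn => exact ⟨ih1, fun hm => hUpd (ih2 hm), by simp⟩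
    | findSnip _ cl k pred curr succ hc => exact ⟨ih1, fun hm => hUpd (ih2 hm), by simp⟩
    | findRestart cl k pred curr succ hc => exact ⟨ih1, fun hm => hUpd (ih2 hm), by simp⟩
    | findAdvance cl k pred curr succ n hn hk => exact ⟨ih1, fun hm => hUpd (ih2 hm), by simp⟩
    | findReturn cl k pred curr succ n hn hk => exact ⟨ih1, fun hm => hUpd (ih2 hm), by simp⟩
    | addRestart k pred succ x hc => exact ⟨ih1, by simp [PC.Marked], by simp⟩
    | remCasFail k node succ hc => exact ⟨ih1, by simp [PC.Marked], by simp⟩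
    | _ => exact ⟨ih1, fun h => h.elim, by simp⟩

end Execution

end LockFreeList

/-! ### Positions in a filtered range -/

namespace List

variable {α : Type*} (f : ℕ → Option α)

theorem filterMap_range_succ (n : ℕ) :
    (range (n + 1)).filterMap f = (range n).filterMap f ++ (f n).toList := by
  rw [range_succ, filterMap_append]
  cases h : f n <;> simp [h]

theorem length_filterMap_range_mono {m n : ℕ} (h : m ≤ n) :
    ((range m).filterMap f).length ≤ ((range n).filterMap f).length := by
  induction n, h using Nat.le_induction with
  | base => exact le_rfl
  | succ n _ ih =>
    rw [filterMap_range_succ, length_append]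
    omega

theorem length_filterMap_range_lt {m n : ℕ} (h : m < n) {a : α} (ha : f m = some a) :
    ((range m).filterMap f).length < ((range n).filterMap f).length := by
  refine lt_of_lt_of_le ?_ (length_filterMap_range_mono f (Nat.succ_le_of_lt h))
  rw [Nat.succ_eq_add_one, filterMap_range_succ, ha]
  simp

/-- The position of an event is the number of labelled steps before it. This links history positions
to times. -/
theorem getElem?_filterMap_range_iff (n p : ℕ) (a : α) :
    ((range n).filterMap f)[p]? = some a ↔
      ∃ c < n, f c = some a ∧ ((range c).filterMap f).length = p := by
  induction n with
  | zero => simp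
  | succ n ih =>
    rw [filterMap_range_succ]
    constructor
    · intro h
      rw [getElem?_append] at h
      split_ifs at h with hp
      · obtain ⟨c, hc, h⟩ := ih.1 h
        exact ⟨c, hc.trans (Nat.lt_succ_self n), h⟩
      · cases hf : f n with
        | none => simp [hf] at h
        | some b =>
          rw [hf, Option.toList_some, getElem?_singleton] at h
          split_ifs at h with h0
          exact ⟨n, Nat.lt_succ_self n, hf.trans h, by omega⟩
    · rintro ⟨c, hc, hf, hp⟩
      rcases Nat.lt_succ_iff_lt_or_eq.1 hc with hc | rfl
      · rw [getElem?_append_left]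
        · exact ih.2 ⟨c, hc, hf, hp⟩
        · rw [← hp]
          exact length_filterMap_range_lt f hc hf
      · rw [getElem?_append_right hp.le, hf]
        simp [hp]

end List

namespace LockFreeList

/-! ### Sequential runs -/

/-- `Run S L S'`: the operations in `L`, executed from the set `S`, return the results in `L`, and
produce the set `S'`. -/
inductive Run : Set ℤ → List (Op × Bool) → Set ℤ → Prop
  | nil (S : Set ℤ) : Run S [] S
  | cons {S S' : Set ℤ} {op : Op} {r : Bool} {L : List (Op × Bool)}
      (h : r = true ↔ op.Succeeds S) (hL : Run (op.next S) L S') : Run S ((op, r) :: L) S'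

theorem Run.legal {S S' : Set ℤ} {L : List (Op × Bool)} (h : Run S L S') : Legal S L := by
  induction h with
  | nil S => trivial
  | cons h _ ih => exact ⟨h, ih⟩

theorem Run.append {S S' S'' : Set ℤ} {L L' : List (Op × Bool)} (h : Run S L S')
    (h' : Run S' L' S'') : Run S (L ++ L') S'' := by
  induction h with
  | nil S => exact h'
  | cons h _ ih => exact .cons h (ih h')

/-- Operations that read one and the same set and change nothing may be run in any order. -/
theorem Run.of_forall {S : Set ℤ} {L : List (Op × Bool)}
    (h : ∀ x ∈ L, (x.2 = true ↔ x.1.Succeeds S) ∧ x.1.next S = S) : Run S L S := by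
  induction L with
  | nil => exact .nil S
  | cons x L ih =>
    obtain ⟨h1, h2⟩ := h x List.mem_cons_self
    refine .cons h1 ?_
    rw [h2]
    exact ih fun y hy => h y (List.mem_cons_of_mem x hy)

theorem Run.flatMap_range {s : ℕ → Set ℤ} {B : ℕ → List (Op × Bool)} {n : ℕ}
    (h : ∀ i < n, Run (s i) (B i) (s (i + 1))) : Run (s 0) ((List.range n).flatMap B) (s n) := by
  induction n with
  | zero => exact .nil _
  | succ n ih =>
    rw [List.range_succ, List.flatMap_append]
    refine (ih fun i hi => h i (hi.trans (Nat.lt_succ_self n))).append ?_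
    simpa using h n (Nat.lt_succ_self n)

/-! ### From positions in the history to steps, and linearization points -/

namespace Execution

variable {T : Type*} [DecidableEq T] (e : Execution T)

/-- The position in the history of the event of step `c`. -/
def pos (c : ℕ) : ℕ := ((List.range c).filterMap e.lab).length

variable {e}

theorem history_getElem? {p : ℕ} {a : T × Act} :
    e.history[p]? = some a ↔ ∃ c < e.len, e.lab c = some a ∧ e.pos c = p :=
  List.getElem?_filterMap_range_iff e.lab e.len p a

theorem pos_mono {c d : ℕ} (h : c ≤ d) : e.pos c ≤ e.pos d :=
  List.length_filterMap_range_mono e.lab h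

theorem pos_lt {c d : ℕ} {a : T × Act} (h : c < d) (hc : e.lab c = some a) : e.pos c < e.pos d :=
  List.length_filterMap_range_lt e.lab h hc

theorem pos_injOn {c d : ℕ} {a b : T × Act} (hc : e.lab c = some a) (hd : e.lab d = some b)
    (h : e.pos c = e.pos d) : c = d := by
  rcases lt_trichotomy c d with h1 | h1 | h1
  · exact absurd h (pos_lt h1 hc).ne
  · exact h1
  · exact absurd h (pos_lt h1 hd).ne'

/-- The operation `op`, invoked by `t` in step `c`, returns `r` in step `d`. -/
def Returns (e : Execution T) (c d : ℕ) (t : T) (op : Op) (r : Bool) : Prop :=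
  d < e.len ∧ e.Span c d t op ∧ e.lab d = some (t, .ret r)

/-- A thread becomes idle only by a response; one strictly between the two events would contradict
that they match, so the thread is busy throughout. -/
theorem returns_of_completes {i j : ℕ} {t : T} {op : Op} {r : Bool}
    (h : Completes e.history i j t op r) :
    ∃ c d, e.pos c = i ∧ e.pos d = j ∧ e.Returns c d t op r := by
  obtain ⟨hij, hi, hj, hm⟩ := h
  obtain ⟨c, hc, hlc, rfl⟩ := history_getElem?.1 hi
  obtain ⟨d, hd, hld, rfl⟩ := history_getElem?.1 hj
  have hcd : c < d := by
    by_contra h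
    exact absurd (pos_mono (e := e) (not_lt.1 h)) (not_le.2 hij)
  refine ⟨c, d, rfl, rfl, hd, ⟨hlc, hcd, hd.le, fun m h1 h2 => ?_⟩, hld⟩
  induction m, h1 using Nat.le_induction with
  | base =>
    have := (localStep_of_lab hc hlc).of_call.2
    rw [Nat.succ_eq_add_one, this]
    cases op <;> simp [Op.start]
  | succ m h1 ih =>
    intro h3
    obtain ⟨r', hr'⟩ := lab_of_to_idle (by omega : m < e.len) (ih (by omega)) h3
    refine hm (e.pos m) (pos_lt h1 hlc) (pos_lt (by omega) hr') r' ?_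
    exact history_getElem?.2 ⟨m, by omega, hr', rfl⟩

theorem Returns.unique {c d d' : ℕ} {t t' : T} {op op' : Op} {r r' : Bool}
    (h : e.Returns c d t op r) (h' : e.Returns c d' t' op' r') :
    d = d' ∧ t = t' ∧ op = op' ∧ r = r' := by
  obtain ⟨hd, s, hl⟩ := h
  obtain ⟨hd', s', hl'⟩ := h'
  have h1 := s.1.symm.trans s'.1
  cases h1
  have h2 := (localStep_of_lab hd hl).of_ret.2
  have h2' := (localStep_of_lab hd' hl').of_ret.2
  have hdd : d = d' := by
    rcases lt_trichotomy d d' with h | h | h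
    · exact absurd h2 (s'.2.2.2 _ (s.2.1.trans (Nat.lt_succ_self d)) h)
    · exact h
    · exact absurd h2' (s.2.2.2 _ (s'.2.1.trans (Nat.lt_succ_self d')) h)
  subst hdd
  have h3 := hl.symm.trans hl'
  cases h3
  exact ⟨rfl, rfl, rfl, rfl⟩

theorem Returns.result {c d i : ℕ} {t : T} {op : Op} {r : Bool} (h : e.Returns c d t op r)
    (hci : c < i) (hid : i < d) {op' : Op} (u : e.Updates i t op') : r = true := by
  obtain ⟨hd, s, hl⟩ := h
  have h1 := u.later hid hd.le fun m h1 h2 => s.2.2.2 m (hci.trans h1) h2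
  rw [(localStep_of_lab hd hl).of_ret.1] at h1
  simpa [PC.Marked] using h1

/-! ### Linearizability -/

/-- The update operation `op`, invoked in step `c`, takes effect in step `i`. -/
def UpdateAt (e : Execution T) (i c : ℕ) (op : Op) : Prop :=
  i < e.len ∧ ∃ t, e.Updates i t op ∧ e.Span c i t op

/-- The operation `op`, invoked in step `c`, returns `r` without changing the set, in accordance
with the abstract set at time `i`. -/
def ReadAt (e : Execution T) (i c : ℕ) (op : Op) (r : Bool) : Prop :=
  ∃ d t, e.Returns c d t op r ∧ c < i ∧ i ≤ d ∧ (r = true ↔ op.Succeeds (absSet (e.heap i))) ∧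
    op.next (absSet (e.heap i)) = absSet (e.heap i) ∧
    -- This clause separates reads from updates; `not_updateAt_of_readAt` rests on it.
    ∀ m, c < m → m < d → ∀ op', ¬ e.Updates m t op'

theorem UpdateAt.unique {i c c' : ℕ} {op op' : Op} (h : e.UpdateAt i c op)
    (h' : e.UpdateAt i c' op') : c = c' ∧ op = op' := by
  obtain ⟨hi, t, u, s⟩ := h
  obtain ⟨-, t', u', s'⟩ := h'
  obtain rfl := u.unique_thread hi u'
  exact s.unique s'

/-- After the first update the operation stays in updated states until it returns, and no update CAS
starts from one of these. -/
theorem UpdateAt.unique_time {i i' c : ℕ} {op op' : Op} (h : e.UpdateAt i c op)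
    (h' : e.UpdateAt i' c op') : i = i' := by
  obtain ⟨hi, t, u, s⟩ := h
  obtain ⟨hi', t', u', s'⟩ := h'
  have h1 := s.1.symm.trans s'.1
  cases h1
  rcases lt_trichotomy i i' with h | h | h
  · exact absurd (u.later h hi'.le fun m h1 h2 => s'.2.2.2 m (s.2.1.trans h1) h2)
      u'.pc_ne.2.2.2.1
  · exact h
  · exact absurd (u'.later h hi.le fun m h1 h2 => s.2.2.2 m (s'.2.1.trans h1) h2)
      u.pc_ne.2.2.2.1

/-- An update takes effect before the operation returns. -/
theorem UpdateAt.lt_of_returns {i c d : ℕ} {t : T} {op op' : Op} {r : Bool}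
    (h : e.UpdateAt i c op) (h' : e.Returns c d t op' r) :
    c < i ∧ i < d ∧ e.Updates i t op ∧ op = op' := by
  obtain ⟨hi, t', u, s⟩ := h
  obtain ⟨hd, s', hl⟩ := h'
  have h1 := s.1.symm.trans s'.1
  cases h1
  refine ⟨s.2.1, ?_, u, rfl⟩
  by_contra hid
  obtain ⟨h2, h3⟩ := (localStep_of_lab hd hl).of_ret
  rcases (not_lt.1 hid).eq_or_lt with rfl | h
  · exact u.pc_ne.2.2.2.2.1 r h2
  · exact s.2.2.2 (d + 1) (s'.2.1.trans (Nat.lt_succ_self d)) h h3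

theorem not_updateAt_of_readAt {i i' c : ℕ} {op op' : Op} {r : Bool} (h : e.ReadAt i c op r)
    (h' : e.UpdateAt i' c op') : False := by
  obtain ⟨d, t, hr, -, -, -, -, hn⟩ := h
  obtain ⟨h1, h2, h3, -⟩ := h'.lt_of_returns hr
  exact hn i' h1 h2 _ h3

/-- Every completed operation has a linearization point. -/
theorem Returns.updateAt_or_readAt {c d : ℕ} {t : T} {op : Op} {r : Bool}
    (h : e.Returns c d t op r) :
    (∃ i, e.UpdateAt i c op ∧ r = true) ∨ ∃ i, e.ReadAt i c op r := by
  have hr := h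
  obtain ⟨hd, s, hl⟩ := h
  -- Operations are classified by whether they performed an update CAS, not by their result.
  by_cases hu : ∃ i op', c < i ∧ i < d ∧ e.Updates i t op'
  · obtain ⟨i, op', hci, hid, u⟩ := hu
    have si := s.anti hci hid.le
    have hop : op' = op := by
      refine si.info.1 op' ?_
      cases op' with
      | add k => obtain ⟨_, _, _, h1, -⟩ := u; rw [h1]; rfl
      | remove k => obtain ⟨_, _, h1, -⟩ := u; rw [h1]; rfl
      | contains k => exact u.elim
    subst hop
    exact Or.inl ⟨i, ⟨hid.trans hd, t, u, si⟩, hr.result hci hid u⟩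
  · right
    rcases s.info.2.2 r (localStep_of_lab hd hl).of_ret.1 with ⟨i, h1, h2, u⟩ | ⟨i, h1, h2, h3, h4⟩
    · exact absurd ⟨i, op, h1, h2, u⟩ hu
    · exact ⟨i, d, t, hr, h1, h2, h3, h4, fun m h5 h6 op' u => hu ⟨m, op', h5, h6, u⟩⟩

theorem Updates.exists_updateAt {i : ℕ} (hi : i < e.len) {t : T} {op : Op}
    (u : e.Updates i t op) : ∃ c, e.UpdateAt i c op := by
  obtain ⟨c, op', s⟩ := exists_span hi.le u.pc_ne.1
  have hop : op = op' := by
    refine s.info.1 op ?_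
    cases op with
    | add k => obtain ⟨_, _, _, h1, -⟩ := u; rw [h1]; rfl
    | remove k => obtain ⟨_, _, h1, -⟩ := u; rw [h1]; rfl
    | contains k => exact u.elim
  subst hop
  exact ⟨c, hi, t, u, s⟩

theorem heap_zero : e.heap 0 = initHeap := by simp [heap, e.init]

theorem absSet_initHeap : absSet initHeap = ∅ := by
  ext k
  simp only [Set.mem_empty_iff_false, iff_false]
  rintro ⟨x, n, -, hn, -, hk⟩
  rcases initHeap_cases hn with ⟨rfl, rfl⟩ | ⟨rfl, rfl⟩
  · exact toKey_ne_bot k hk.symm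
  · exact toKey_ne_top k hk.symm

/-- A choice of linearization points, and the sequences of operations linearized at each time. -/
theorem exists_linearization (e : Execution T) : ∃ B : ℕ → List (ℕ × Op × Bool),
    (∀ i < e.len, Run (absSet (e.heap i)) ((B i).map Prod.snd) (absSet (e.heap (i + 1)))) ∧
    (∀ i, ((B i).map Prod.fst).Nodup) ∧
    (∀ i i', ∀ x ∈ B i, ∀ y ∈ B i', x.1 = y.1 → i = i') ∧
    (∀ i, ∀ x ∈ B i, x.2.2 = true ∧ e.UpdateAt i x.1 x.2.1 ∨ e.ReadAt i x.1 x.2.1 x.2.2) ∧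
    (∀ c d t op r, e.Returns c d t op r → ∃ i < e.len, (c, op, r) ∈ B i) := by
  classical
  -- An operation may have several read points, so one is chosen per invocation. Updates are instead
  -- indexed by their step, which determines the operation.
  have hρ : ∀ c, ∃ o : Option (ℕ × Op × Bool),
      (∀ x, o = some x → e.ReadAt x.1 c x.2.1 x.2.2) ∧
      (o = none → ∀ i op r, ¬ e.ReadAt i c op r) := by
    intro c
    by_cases h : ∃ i op r, e.ReadAt i c op r
    · obtain ⟨i, op, r, h⟩ := h
      refine ⟨some (i, op, r), ?_, by simp⟩
      rintro _ ⟨⟩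
      exact h
    · push Not at h
      exact ⟨none, by simp, fun _ => h⟩
  have hυ : ∀ i, ∃ o : Option (ℕ × Op), (∀ x, o = some x → e.UpdateAt i x.1 x.2) ∧
      (o = none → ∀ c op, ¬ e.UpdateAt i c op) := by
    intro i
    by_cases h : ∃ c op, e.UpdateAt i c op
    · obtain ⟨c, op, h⟩ := h
      refine ⟨some (c, op), ?_, by simp⟩
      rintro _ ⟨⟩
      exact h
    · push Not at h
      exact ⟨none, by simp, fun _ => h⟩
  choose ρ hρ hρn using hρ
  choose υ hυ hυn using hυ
  let R : ℕ → List (ℕ × Op × Bool) := fun i => (List.range e.len).filterMap fun c =>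
    (ρ c).bind fun y => if y.1 = i then some (c, y.2) else none
  -- Pending updates that have taken effect are included too, completed with the result `true`.
  let U : ℕ → List (ℕ × Op × Bool) := fun i => ((υ i).map fun y => (y.1, y.2, true)).toList
  have hR : ∀ i x, x ∈ R i ↔ x.1 < e.len ∧ ρ x.1 = some (i, x.2) := by
    rintro i ⟨c, x⟩
    simp only [R, List.mem_filterMap, List.mem_range, Option.bind_eq_some_iff]
    constructor
    · rintro ⟨c', hc', ⟨j, y⟩, h1, h2⟩
      split_ifs at h2 with h3
      obtain ⟨rfl, rfl⟩ := Prod.mk.inj (Option.some.inj h2)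
      obtain rfl : j = i := h3
      exact ⟨hc', h1⟩
    · rintro ⟨h1, h2⟩
      exact ⟨c, h1, (i, x), h2, by simp⟩
  have hU : ∀ i x, x ∈ U i ↔ υ i = some (x.1, x.2.1) ∧ x.2.2 = true := by
    rintro i ⟨c, op, r⟩
    simp only [U, Option.mem_toList, Option.map_eq_some_iff]
    constructor
    · rintro ⟨⟨c', op'⟩, h1, h2⟩
      cases h2
      exact ⟨h1, rfl⟩
    · rintro ⟨h1, h2⟩
      obtain rfl : r = true := h2
      exact ⟨_, h1, rfl⟩
  have hRA : ∀ i x, x ∈ R i → e.ReadAt i x.1 x.2.1 x.2.2 :=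
    fun i x hx => hρ _ _ ((hR i x).1 hx).2
  have hUA : ∀ i x, x ∈ U i → e.UpdateAt i x.1 x.2.1 :=
    fun i x hx => hυ _ _ ((hU i x).1 hx).1
  -- The reads come first: they refer to the set at time `i`, before the update of step `i`.
  refine ⟨fun i => R i ++ U i, ?_, ?_, ?_, ?_, ?_⟩
  · intro i hi
    rw [List.map_append]
    refine Run.append (S' := absSet (e.heap i)) (Run.of_forall ?_) ?_
    · intro x hx
      obtain ⟨y, hy, rfl⟩ := List.mem_map.1 hx
      obtain ⟨d, t, -, -, -, h1, h2, -⟩ := hRA i y hy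
      exact ⟨h1, h2⟩
    · cases h : υ i with
      | none =>
        have : absSet (e.heap (i + 1)) = absSet (e.heap i) := by
          refine absSet_eq_of_not_updates hi ?_
          rintro ⟨t, op, u⟩
          obtain ⟨c, hc⟩ := u.exists_updateAt hi
          exact hυn i h c op hc
        simp only [U, h, this]
        exact .nil _
      | some x =>
        obtain ⟨-, t, u, -⟩ := hυ i x h
        obtain ⟨h1, h2⟩ := u.absSet_succ hi
        simp only [U, h, h2]
        exact .cons (by simpa using h1) (.nil _)
  · intro i
    rw [List.map_append, List.nodup_append]
    refine ⟨?_, ?_, ?_⟩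
    · rw [List.Nodup, List.pairwise_map, List.pairwise_filterMap]
      refine List.Pairwise.imp ?_ (List.nodup_range (n := e.len))
      intro c c' hne x hx y hy
      rw [Option.bind_eq_some_iff] at hx hy
      obtain ⟨_, -, hx⟩ := hx
      obtain ⟨_, -, hy⟩ := hy
      split_ifs at hx hy
      cases hx
      cases hy
      exact hne
    · cases h : υ i <;> simp [U, h]
    · intro a ha b hb hab
      obtain ⟨x, hx, rfl⟩ := List.mem_map.1 ha
      obtain ⟨y, hy, rfl⟩ := List.mem_map.1 hb
      have h2 := hUA i y hy
      rw [← hab] at h2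
      exact not_updateAt_of_readAt (hRA i x hx) h2
  · intro i i' x hx y hy hxy
    rcases List.mem_append.1 hx with hx | hx <;> rcases List.mem_append.1 hy with hy | hy
    · have h1 := ((hR i x).1 hx).2
      have h2 := ((hR i' y).1 hy).2
      rw [hxy, h2] at h1
      exact (congrArg Prod.fst (Option.some.inj h1)).symm
    · have h2 := hUA i' y hy
      rw [← hxy] at h2
      exact (not_updateAt_of_readAt (hRA i x hx) h2).elim
    · have h2 := hUA i x hx
      rw [hxy] at h2
      exact (not_updateAt_of_readAt (hRA i' y hy) h2).elim
    · have h2 := hUA i x hx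
      rw [hxy] at h2
      exact h2.unique_time (hUA i' y hy)
  · intro i x hx
    rcases List.mem_append.1 hx with hx | hx
    · exact Or.inr (hRA i x hx)
    · exact Or.inl ⟨((hU i x).1 hx).2, hUA i x hx⟩
  · intro c d t op r h
    rcases h.updateAt_or_readAt with ⟨i, hu, rfl⟩ | ⟨i, hr⟩
    · refine ⟨i, hu.1, List.mem_append_right _ ((hU i _).2 ⟨?_, rfl⟩)⟩
      cases hx : υ i with
      | none => exact absurd hu (hυn i hx c op)
      | some x =>
        obtain ⟨h1, h2⟩ := (hυ i x hx).unique hu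
        exact congrArg some (Prod.ext h1 h2)
    · cases hx : ρ c with
      | none => exact absurd hr (hρn c hx i op r)
      | some x =>
        obtain ⟨d', t', hr', -, hid, -⟩ := hρ c x hx
        obtain ⟨rfl, -, h1, h2⟩ := h.unique hr'
        refine ⟨x.1, hid.trans_lt h.1, List.mem_append_left _ ((hR _ _).2 ⟨?_, ?_⟩)⟩
        · exact h.2.1.2.1.trans h.1
        · rw [hx]
          exact congrArg some (Prod.ext rfl (Prod.ext h1.symm h2.symm))

/-- If `x` is placed at time `i` and `y` at `i' ≥ i`, then the invocation of `x` precedes `i`, while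
`y` does not return before `i'`; so `y` cannot have returned before `x` was invoked. -/
theorem linearizable (e : Execution T) : Linearizable e.history := by
  obtain ⟨B, hrun, hnodup, hdisj, hmem, hcomp⟩ := e.exists_linearization
  have hlab : ∀ i, ∀ x ∈ B i, ∃ t, x.1 < i ∧ x.1 < e.len ∧ e.lab x.1 = some (t, .call x.2.1) := by
    intro i x hx
    rcases hmem i x hx with ⟨-, hi, t, -, s⟩ | ⟨d, t, h, hci, -⟩
    · exact ⟨t, s.2.1, s.2.1.trans hi, s.1⟩
    · exact ⟨t, hci, h.2.1.2.1.trans h.1, h.2.1.1⟩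
  have hbefore : ∀ i, ∀ x ∈ B i, ∀ d t op r, e.Returns x.1 d t op r → i ≤ d := by
    intro i x hx d t op r h
    rcases hmem i x hx with ⟨-, hu⟩ | ⟨d', t', h', -, hid, -⟩
    · exact (hu.lt_of_returns h).2.1.le
    · rw [(h.unique h').1]
      exact hid
  let L := (List.range e.len).flatMap B
  have hL : ∀ x, x ∈ L ↔ ∃ i < e.len, x ∈ B i := by
    intro x
    simp [L, List.mem_flatMap]
  refine ⟨L.map fun x => (e.pos x.1, x.2), ?_, ?_, ?_, ?_, ?_⟩
  · rw [List.map_map, List.Nodup, List.pairwise_map, List.pairwise_flatMap]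
    have hne : ∀ i i', ∀ x ∈ B i, ∀ y ∈ B i', x.1 ≠ y.1 → e.pos x.1 ≠ e.pos y.1 := by
      intro i i' x hx y hy hxy h
      obtain ⟨t, -, -, h1⟩ := hlab i x hx
      obtain ⟨t', -, -, h2⟩ := hlab i' y hy
      exact hxy (pos_injOn h1 h2 h)
    constructor
    · intro i _
      have := hnodup i
      rw [List.Nodup, List.pairwise_map] at this
      exact this.imp_of_mem fun {x y} hx hy hxy => hne i i x hx y hy hxy
    · refine List.Pairwise.imp ?_ (List.nodup_range (n := e.len))
      intro i i' hii x hx y hy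
      exact hne i i' x hx y hy fun h => hii (hdisj i i' x hx y hy h)
  · intro y hy
    obtain ⟨x, hx, rfl⟩ := List.mem_map.1 hy
    obtain ⟨i, hi, hx⟩ := (hL x).1 hx
    obtain ⟨t, -, h1, h2⟩ := hlab i x hx
    exact ⟨t, history_getElem?.2 ⟨x.1, h1, h2, rfl⟩⟩
  · intro i j t op r h
    obtain ⟨c, d, rfl, rfl, h'⟩ := returns_of_completes h
    exact List.mem_map.2 ⟨(c, op, r), (hL _).2 (hcomp c d t op r h'), rfl⟩
  · have key : ∀ i i', i ≤ i' → ∀ x ∈ B i, ∀ y ∈ B i', ∀ j t op r,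
        Completes e.history (e.pos y.1) j t op r → ¬ j < e.pos x.1 := by
      intro i i' hii x hx y hy j t op r h hj
      obtain ⟨c, d, hc, rfl, h'⟩ := returns_of_completes h
      obtain ⟨t', hxi, -, -⟩ := hlab i x hx
      obtain ⟨t'', -, -, hy'⟩ := hlab i' y hy
      obtain rfl := pos_injOn h'.2.1.1 hy' hc
      have h1 := hbefore i' y hy _ _ _ _ h'
      have h2 : d < x.1 := by
        by_contra h3
        exact absurd (pos_mono (e := e) (not_lt.1 h3)) (not_le.2 hj)
      omega
    rw [List.pairwise_map, List.pairwise_flatMap]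
    constructor
    · intro i _
      exact List.pairwise_of_forall_mem_list fun x hx y hy => key i i le_rfl x hx y hy
    · refine List.Pairwise.imp ?_ (List.pairwise_lt_range (n := e.len))
      intro i i' hii x hx y hy
      exact key i i' hii.le x hx y hy
  · have h := Run.flatMap_range (s := fun i => absSet (e.heap i)) hrun
    rw [heap_zero, absSet_initHeap] at h
    have h2 : (L.map fun x => (e.pos x.1, x.2)).map Prod.snd =
        (List.range e.len).flatMap fun i => (B i).map Prod.snd := by
      rw [List.map_map, List.map_flatMap]
      rfl
    rw [h2]
    exact h.legal

end Execution

end LockFreeList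

/-! ### Assembly of the theorem -/

theorem mainTheorem4 {T : Type*} [DecidableEq T] (e : LockFreeList.Execution T) :
    -- the history is linearizable
    LockFreeList.Linearizable e.history ∧
    -- state invariants
    (∀ i ≤ e.len,
      -- the tail is reachable
      LockFreeList.Reachable (e.heap i) LockFreeList.tail ∧
      -- unmarked nodes are reachable
      (∀ x n, e.Published i x → e.heap i x = some n → n.mark = false →
        LockFreeList.Reachable (e.heap i) x) ∧
      -- the list is sorted
      (∀ x y n m, e.heap i x = some n → n.ref = some y → e.heap i y = some m → n.key < m.key)) ∧
    -- transition invariants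
    (∀ i < e.len, ∀ x n, e.heap i x = some n → ∃ n', e.heap (i + 1) x = some n' ∧
      -- keys are immutable
      n'.key = n.key ∧
      -- a marked field is immutable
      (n.mark = true → n'.next = n.next) ∧
      -- a node is reachable right after it gets marked
      (n.mark = false → n'.mark = true → LockFreeList.Reachable (e.heap (i + 1)) x)) ∧
    -- a successful insertion by a CAS of `add`
    (∀ i < e.len, ∀ t k pred succ newNode, e.pc i t = .addCas k pred succ newNode →
      e.pc (i + 1) t = .ret true →
      k ∉ LockFreeList.absSet (e.heap i) ∧
      LockFreeList.absSet (e.heap (i + 1)) = insert k (LockFreeList.absSet (e.heap i))) ∧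
    -- a successful marking by a CAS of `remove`
    (∀ i < e.len, ∀ t k node succ, e.pc i t = .remCas k node succ →
      e.pc (i + 1) t = .remReread k node true →
      k ∈ LockFreeList.absSet (e.heap i) ∧
      LockFreeList.absSet (e.heap (i + 1)) = LockFreeList.absSet (e.heap i) \ {k}) ∧
    -- every other step, in particular every step of `find`, preserves the abstract set
    (∀ i < e.len,
      (¬ ∃ t k pred succ newNode, e.pc i t = .addCas k pred succ newNode ∧
        e.pc (i + 1) t = .ret true) →
      (¬ ∃ t k node succ, e.pc i t = .remCas k node succ ∧
        e.pc (i + 1) t = .remReread k node true) →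
      LockFreeList.absSet (e.heap (i + 1)) = LockFreeList.absSet (e.heap i)) ∧
    -- the pair of nodes returned by `find`
    (∀ j ≤ e.len, ∀ t c k pred curr, e.pc j t = .found c k pred curr →
      (∃ p q, e.heap j pred = some p ∧ e.heap j curr = some q ∧
        p.key < LockFreeList.toKey k ∧ LockFreeList.toKey k ≤ q.key) ∧
      e.PastFind t j (fun h => ∃ p, h pred = some p ∧ p.next = (some curr, false)) ∧
      e.PastFind t j (fun h => ∃ q, h curr = some q ∧ q.mark = false)) ∧
    -- the assertion at the beginning of the loop body of `contains`
    (∀ j ≤ e.len, ∀ t k curr succ marked, e.pc j t = .conBody k curr succ marked →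
      e.Past t j (fun h => LockFreeList.SearchPath h k curr ∧
        ∃ n, h curr = some n ∧ n.mark = marked)) ∧
    -- the assertion after the loop of `contains`
    (∀ j ≤ e.len, ∀ t k curr marked, e.pc j t = .conExit k curr marked →
      (∃ n, e.heap j curr = some n ∧ LockFreeList.toKey k ≤ n.key) ∧
      e.Past t j (fun h => LockFreeList.SearchPath h k curr ∧
        ∃ n, h curr = some n ∧
          ((marked = true → n.key = LockFreeList.toKey k) → n.mark = marked))) := by
  refine ⟨e.linearizable, ?_, ?_, ?_, ?_, ?_, ?_, ?_, ?_⟩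
  · intro i hi
    have I := e.heapInv hi
    refine ⟨?_, fun x n hx hn hm => I.unmarked x hx n hn hm, I.sorted⟩
    -- The tail is published and never marked, so its reachability is an instance of that of
    -- unmarked nodes.
    obtain ⟨n, hn, -, hm⟩ := I.tail
    exact I.unmarked _ I.tail_mem n hn hm
  · intro i hi x n hn
    obtain ⟨X, s⟩ := e.heapStep hi
    exact s.next x n hn
  · intro i hi t k pred succ x h1 h2
    exact e.absSet_addCas hi h1 h2
  · intro i hi t k node succ h1 h2
    exact e.absSet_remCas hi h1 h2
  · intro i hi h1 h2
    exact e.absSet_of_no_update hi h1 h2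
  · intro j hj t c k pred curr h
    have hp := (e.configInv hj).thread t
    have ht := e.timeInv hj t
    rw [h] at hp ht
    obtain ⟨-, ⟨p, hp, hpk⟩, -, q, hq, hqk⟩ := hp
    exact ⟨⟨p, q, hp, hq, hpk, hqk⟩, ht.1.mono fun i _ ⟨p, h1, h2, _⟩ => ⟨p, h1, h2⟩,
      ht.2.mono fun i _ ⟨q, h1, h2, _⟩ => ⟨q, h1, h2⟩⟩
  · intro j hj t k curr succ marked h
    have ht := e.timeInv hj t
    rw [h] at ht
    simp only [LockFreeList.Execution.TimeInv] at ht
    exact ht.mono fun i _ ⟨h1, n, h2, _, h3⟩ =>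
      ⟨h1, n, h2, LockFreeList.Node.mark_of_next h3⟩
  · intro j hj t k curr marked h
    have ht := e.timeInv hj t
    rw [h] at ht
    exact ht
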